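/- Let $W=(W_t)_{t\in[0,1]}$ be an $n$-dimensional standard Brownian motion with almost surely continuous paths on a probability space $(\Omega,\mathcal F,\mathbb P)$; random variables are understood to be measurable with respect to the $\mathbb P$-completion of $\mathcal F$. Let $H^1$ be the Cameron–Martin space of absolutely continuous $h:[0,1]\to\mathbb R^n$ with $h(0)=0$ and $h'\in L^2([0,1],\mathbb R^n)$, with scalar product $\langle h,k\rangle_{H^1}=\int_0^1\langle h'(s),k'(s)\rangle\,ds$. If $\mathcal P$ is an orthogonal projection of $H^1$ with finite-dimensional range and $(h_1,\dots,h_d)$ is an orthonormal basis of its range, put $\mathcal P^W=\sum_{i=1}^d\big(\int_0^1\langle h_i'(s),dW_s\rangle\big)h_i$. An approximating sequence of projections is a sequence $(\mathcal P_k)$ of orthogonal projections of $H^1$ with finite-dimensional ranges that converges strongly to the identity. A random variable $\tilde{\mathcal N}$ with values in $[0,\infty]$ is a stochastic extension of a seminorm $\mathcal N$ on $H^1$ if $\tilde{\mathcal N}<\infty$ almost surely, $\mathcal N(\mathcal P_k^W)\to\tilde{\mathcal N}$ in probability for every approximating sequence of projections $(\mathcal P_k)$, and $\mathbb P(\tilde{\mathcal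 N}\le\varepsilon)>0$ for every $\varepsilon>0$. A seminorm is measurable if it has a stochastic extension; a measurable norm is a norm that is measurable as a seminorm. For $f:[0,1]\to\mathbb R^n$ let $\|f\|_\alpha=\sup_{t}|f(t)|+\sup_{s\ne t}\frac{|f(s)-f(t)|}{|s-t|^\alpha}$, where $|\cdot|$ is the Euclidean norm. **Lemma 2.8.** Let $g:[0,1]\to\mathbb R^{n\times n}$ be of class $C^2$ and let $0<m\le\det g(t)\le M$ for all $t\in[0,1]$ (for $n=1$: $m\le g(t)\le M$). Let $0<\alpha<\frac12$. Then $$\mathcal N_g(h):=\Big\|\int_0^{\cdot}g(s)h'(s)\,ds\Big\|_\alpha,\qquad h\in H^1,$$ is a measurable norm on $H^1$. Moreover the process of Wiener integrals $t\mapsto\int_0^t g(s)\,dW_s$ has a version with almost surely continuous paths, and for every such version $\tilde{\mathcal N}_g:=\big\|\int_0^{\cdot}g(s)\,dW_s\big\|_\alpha$ is a stochastic extension of $\mathcal N_g$. -/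

import Mathlib

open MeasureTheory ProbabilityTheory Filter Topology Set
open scoped ENNReal NNReal InnerProductSpace

namespace WienerSpace

/-- Euclidean space `ℝⁿ`. -/
abbrev E (n : ℕ) : Type := EuclideanSpace ℝ (Fin n)

/-- Lebesgue measure on `[0, 1]`. -/
noncomputable abbrev leb : Measure ℝ := volume.restrict (Icc (0 : ℝ) 1)

/-! ### The Cameron-Martin space -/

/-- The derivative of a function on `[0, 1]`. (The function is extended by constants to the whole
line; this does not affect the derivative at interior points.) -/
noncomputable def pathDeriv {n : ℕ} (h : unitInterval → E n) : ℝ → E n :=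
  deriv (IccExtend (zero_le_one' ℝ) h)

/-- `h(0) = 0`, `h` is absolutely continuous on `[0, 1]`, and `h' ∈ L²([0, 1], ℝⁿ)`. -/
structure IsCameronMartin {n : ℕ} (h : unitInterval → E n) : Prop where
  zero : h 0 = 0
  ac : AbsolutelyContinuousOnInterval (IccExtend (zero_le_one' ℝ) h) 0 1
  memLp : MemLp (pathDeriv h) 2 leb

theorem IsCameronMartin.ae_diff {n : ℕ} {h : unitInterval → E n} (hh : IsCameronMartin h) :
    ∀ᵐ x ∂leb, DifferentiableAt ℝ (IccExtend (zero_le_one' ℝ) h) x := by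
  have := hh.ac.boundedVariationOn.ae_differentiableAt_of_mem_uIcc
  rw [uIcc_of_le zero_le_one] at this
  exact (ae_restrict_iff' measurableSet_Icc).2 this

theorem pathDeriv_add {n : ℕ} {h k : unitInterval → E n} (hh : IsCameronMartin h)
    (hk : IsCameronMartin k) : pathDeriv (h + k) =ᵐ[leb] pathDeriv h + pathDeriv k := by
  filter_upwards [hh.ae_diff, hk.ae_diff] with x h1 h2
  exact (h1.hasDerivAt.add h2.hasDerivAt).deriv

theorem pathDeriv_smul {n : ℕ} (c : ℝ) {h : unitInterval → E n} (hh : IsCameronMartin h) :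
    pathDeriv (c • h) =ᵐ[leb] c • pathDeriv h := by
  filter_upwards [hh.ae_diff] with x h1
  exact (h1.hasDerivAt.const_smul c).deriv

/-- The Cameron-Martin functions, as a linear subspace of all functions `[0, 1] → ℝⁿ`. -/
def cameronMartinSubmodule (n : ℕ) : Submodule ℝ (unitInterval → E n) where
  carrier := {h | IsCameronMartin h}
  zero_mem' := by
    have h0 : IccExtend (zero_le_one' ℝ) (0 : unitInterval → E n) = fun _ => 0 := rfl
    refine ⟨rfl, ?_, ?_⟩
    · rw [h0]
      exact (LipschitzWith.const (0 : E n)).lipschitzOnWith.absolutelyContinuousOnInterval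
    · have : pathDeriv (0 : unitInterval → E n) = fun _ => 0 := by
        unfold pathDeriv
        rw [h0]
        simp
      rw [this]
      exact MemLp.zero'
  add_mem' {h k} hh hk :=
    ⟨by simp [hh.zero, hk.zero], hh.ac.add hk.ac,
      (memLp_congr_ae (pathDeriv_add hh hk)).2 (hh.memLp.add hk.memLp)⟩
  smul_mem' c h hh :=
    ⟨by simp [hh.zero], hh.ac.const_smul c,
      (memLp_congr_ae (pathDeriv_smul c hh)).2 (hh.memLp.const_smul c)⟩

/-- The Cameron-Martin space `H¹`: absolutely continuous functions `h : [0, 1] → ℝⁿ` with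
`h(0) = 0` and `h' ∈ L²`. (A separate type, so that its topology is the one of its own inner
product.) -/
def H1 (n : ℕ) : Type := cameronMartinSubmodule n

theorem integrable_inner_of_memLp {n : ℕ} {f g : ℝ → E n} (hf : MemLp f 2 leb)
    (hg : MemLp g 2 leb) : Integrable (fun s => ⟪f s, g s⟫_ℝ) leb := by
  refine (L2.integrable_inner (𝕜 := ℝ) (hf.toLp f) (hg.toLp g)).congr ?_
  filter_upwards [hf.coeFn_toLp, hg.coeFn_toLp] with s h1 h2
  rw [h1, h2]

namespace H1

variable {n : ℕ}

noncomputable instance : AddCommGroup (H1 n) :=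
  inferInstanceAs (AddCommGroup (cameronMartinSubmodule n))

noncomputable instance : Module ℝ (H1 n) :=
  inferInstanceAs (Module ℝ (cameronMartinSubmodule n))

/-- The underlying function `[0, 1] → ℝⁿ`. -/
def path (h : H1 n) : unitInterval → E n := h.1

/-- The derivative `h'`. -/
noncomputable def der (h : H1 n) : ℝ → E n := pathDeriv h.path

theorem isCameronMartin (h : H1 n) : IsCameronMartin h.path := h.2

theorem memLp_der (h : H1 n) : MemLp h.der 2 leb := h.isCameronMartin.memLp

theorem der_add (h k : H1 n) : (h + k).der =ᵐ[leb] h.der + k.der :=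
  pathDeriv_add h.isCameronMartin k.isCameronMartin

theorem der_smul (c : ℝ) (h : H1 n) : (c • h).der =ᵐ[leb] c • h.der :=
  pathDeriv_smul c h.isCameronMartin

theorem eq_zero_of_der (h : H1 n) (h0 : h.der =ᵐ[leb] 0) : h = 0 := by
  have key : ∀ᵐ x, x ∈ uIcc (0 : ℝ) 1 →
      HasDerivAt (IccExtend (zero_le_one' ℝ) h.path) 0 x := by
    rw [uIcc_of_le zero_le_one, ← ae_restrict_iff' measurableSet_Icc]
    filter_upwards [h.isCameronMartin.ae_diff, h0] with x h1 h2
    have h3 := h1.hasDerivAt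
    have h4 : deriv (IccExtend (zero_le_one' ℝ) h.path) x = 0 := h2
    rwa [h4] at h3
  obtain ⟨C, hC⟩ := h.isCameronMartin.ac.const_of_ae_hasDerivAt_zero key
  rw [uIcc_of_le zero_le_one] at hC
  have e : ∀ t : unitInterval, h.path t = C := fun t => by
    have := hC t t.2
    rwa [IccExtend_of_mem _ _ t.2] at this
  apply Subtype.ext
  funext t
  have h1 : h.path 0 = 0 := h.isCameronMartin.zero
  change h.path t = 0
  rw [e t, ← e 0, h1]

/-- The scalar product `⟨h, k⟩ = ∫₀¹ ⟨h'(s), k'(s)⟩ ds`. -/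
@[reducible]
noncomputable def core : InnerProductSpace.Core ℝ (H1 n) where
  inner h k := ∫ s, ⟪h.der s, k.der s⟫_ℝ ∂leb
  conj_inner_symm h k := by simp [real_inner_comm]
  re_inner_nonneg h := integral_nonneg fun s => real_inner_self_nonneg
  add_left h k l := by
    rw [← integral_add (integrable_inner_of_memLp h.memLp_der l.memLp_der)
      (integrable_inner_of_memLp k.memLp_der l.memLp_der)]
    apply integral_congr_ae
    filter_upwards [der_add h k] with s hs
    rw [hs, Pi.add_apply, inner_add_left]
  smul_left h k c := by
    simp only [conj_trivial]
    rw [← integral_const_mul]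
    apply integral_congr_ae
    filter_upwards [der_smul c h] with s hs
    rw [hs, Pi.smul_apply, real_inner_smul_left]
  definite h hh := by
    apply eq_zero_of_der
    have := (integral_eq_zero_iff_of_nonneg (fun s => real_inner_self_nonneg)
      (integrable_inner_of_memLp h.memLp_der h.memLp_der)).1 hh
    filter_upwards [this] with s hs
    exact inner_self_eq_zero.1 hs

noncomputable instance : NormedAddCommGroup (H1 n) :=
  @InnerProductSpace.Core.toNormedAddCommGroup ℝ (H1 n) _ _ _ core

noncomputable instance : InnerProductSpace ℝ (H1 n) :=
  InnerProductSpace.ofCore core.toCore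

theorem inner_def (h k : H1 n) : ⟪h, k⟫_ℝ = ∫ s, ⟪h.der s, k.der s⟫_ℝ ∂leb := rfl

end H1

/-! ### Brownian motion and the Wiener integral -/

section

variable {Ω : Type*} [MeasurableSpace Ω] {n : ℕ}

/-- `n`-dimensional standard Brownian motion on `[0, 1]`: a centred Gaussian process with
covariance `E[Wⁱ_s Wʲ_t] = δᵢⱼ min(s, t)` and almost surely continuous paths. -/
structure IsBrownianMotion (W : unitInterval → Ω → E n) (P : Measure Ω) : Prop where
  gaussian : IsGaussianProcess W P
  mean : ∀ t i, ∫ ω, W t ω i ∂P = 0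
  cov : ∀ s t i j, ∫ ω, W s ω i * W t ω j ∂P = if i = j then min (s : ℝ) (t : ℝ) else 0
  continuous_paths : ∀ᵐ ω ∂P, Continuous fun t => W t ω

variable {W : unitInterval → Ω → E n} {P : Measure Ω}

theorem IsBrownianMotion.memLp (hW : IsBrownianMotion W P) (t : unitInterval) (i : Fin n) :
    MemLp (fun ω => W t ω i) 2 P := by
  have h := (hW.gaussian.hasGaussianLaw_eval t).memLp_two
  exact (EuclideanSpace.proj (𝕜 := ℝ) i : E n →L[ℝ] ℝ).comp_memLp' h

/-- The step function `1_{[0, t]} eᵢ`, as an element of `L²([0, 1], ℝⁿ)`. -/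
noncomputable def stepFun (p : unitInterval × Fin n) : Lp (E n) 2 leb :=
  indicatorConstLp 2 (measurableSet_Icc (a := (0 : ℝ)) (b := (p.1 : ℝ))) (measure_ne_top _ _)
    (EuclideanSpace.single p.2 (1 : ℝ))

/-- Formal linear combinations of pairs `(t, i)` mapped to `L²([0, 1], ℝⁿ)` by
`(t, i) ↦ 1_{[0, t]} eᵢ`. -/
noncomputable def stepMap (n : ℕ) : ((unitInterval × Fin n) →₀ ℝ) →ₗ[ℝ] Lp (E n) 2 leb :=
  Finsupp.linearCombination ℝ stepFun

/-- Formal linear combinations of pairs `(t, i)` mapped to `L²(P)` by `(t, i) ↦ Wⁱ_t`. -/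
noncomputable def brownianMap (hW : IsBrownianMotion W P) :
    ((unitInterval × Fin n) →₀ ℝ) →ₗ[ℝ] Lp ℝ 2 P :=
  Finsupp.linearCombination ℝ fun p => (hW.memLp p.1 p.2).toLp (fun ω => W p.1 ω p.2)

/-- The Wiener integral `f ↦ ∫₀¹ ⟨f(s), dW_s⟩`, from `L²([0, 1], ℝⁿ)` to `L²(P)`: the extension
by continuity of the linear map with `1_{[0, t]} eᵢ ↦ Wⁱ_t` on step functions. It is an extension
by `wienerMap_step`, and it is determined by this by `denseRange_stepMap`. -/
noncomputable def wienerMap (hW : IsBrownianMotion W P) : Lp (E n) 2 leb →L[ℝ] Lp ℝ 2 P :=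
  (brownianMap hW).extendOfNorm (stepMap n)

theorem inner_stepFun (p q : unitInterval × Fin n) :
    ⟪stepFun p, stepFun q⟫_ℝ = if p.2 = q.2 then min (p.1 : ℝ) (q.1 : ℝ) else 0 := by
  obtain ⟨s, i⟩ := p
  obtain ⟨t, j⟩ := q
  have h0 : 0 ≤ min (s : ℝ) (t : ℝ) := le_min s.2.1 t.2.1
  have h1 : min (s : ℝ) (t : ℝ) ≤ 1 := (min_le_left _ _).trans s.2.2
  have hv : leb.real (Icc (0 : ℝ) s ∩ Icc (0 : ℝ) t) = min (s : ℝ) (t : ℝ) := by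
    rw [Icc_inter_Icc, measureReal_restrict_apply measurableSet_Icc, Icc_inter_Icc]
    simp [h0, h1]
  rw [stepFun, stepFun, L2.inner_indicatorConstLp_indicatorConstLp, hv]
  by_cases h : i = j
  · simp [h]
  · simp [h, EuclideanSpace.inner_single_left]

theorem inner_brownianMap (hW : IsBrownianMotion W P) (x y : (unitInterval × Fin n) →₀ ℝ) :
    ⟪brownianMap hW x, brownianMap hW y⟫_ℝ = ⟪stepMap n x, stepMap n y⟫_ℝ := by
  induction x using Finsupp.induction_linear with
  | zero => simp
  | add f g hf hg => simp only [map_add, inner_add_left, hf, hg]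
  | single p a =>
    induction y using Finsupp.induction_linear with
    | zero => simp
    | add f g hf hg => simp only [map_add, inner_add_right, hf, hg]
    | single q b =>
      have key : ⟪(hW.memLp p.1 p.2).toLp (fun ω => W p.1 ω p.2),
          (hW.memLp q.1 q.2).toLp (fun ω => W q.1 ω q.2)⟫_ℝ = ⟪stepFun p, stepFun q⟫_ℝ := by
        rw [inner_stepFun, ← hW.cov p.1 q.1 p.2 q.2, L2.inner_def]
        apply integral_congr_ae
        filter_upwards [(hW.memLp p.1 p.2).coeFn_toLp, (hW.memLp q.1 q.2).coeFn_toLp]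
          with ω h1 h2
        rw [h1, h2]
        simp [mul_comm]
      simp only [brownianMap, stepMap, Finsupp.linearCombination_single, real_inner_smul_left,
        real_inner_smul_right, key]

theorem norm_brownianMap (hW : IsBrownianMotion W P) (x : (unitInterval × Fin n) →₀ ℝ) :
    ‖brownianMap hW x‖ = ‖stepMap n x‖ := by
  rw [norm_eq_sqrt_real_inner, norm_eq_sqrt_real_inner, inner_brownianMap]

theorem denseRange_stepMap (n : ℕ) : DenseRange (stepMap n) := by
  have hd : Dense ((LinearMap.range (stepMap n) : Submodule ℝ (Lp (E n) 2 leb)) :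
      Set (Lp (E n) 2 leb)) := by
    rw [Submodule.dense_iff_topologicalClosure_eq_top, Submodule.topologicalClosure_eq_top_iff,
      Submodule.eq_bot_iff]
    intro v hv
    have hint : Integrable v leb := (Lp.memLp v).integrable one_le_two
    have h0 : ∀ t : unitInterval, ∫ s in Icc (0 : ℝ) t, v s ∂leb = 0 := by
      intro t
      ext i
      have h1 := (Submodule.mem_orthogonal _ v).1 hv (stepFun (t, i))
        ⟨Finsupp.single (t, i) 1, by simp [stepMap]⟩
      rw [stepFun, L2.inner_indicatorConstLp_eq_inner_setIntegral] at h1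
      simpa [EuclideanSpace.inner_single_left] using h1
    have hii : IntervalIntegrable v volume 0 1 := by
      rw [intervalIntegrable_iff_integrableOn_Icc_of_le zero_le_one]
      exact hint
    have h2 : ∀ x ∈ Icc (0 : ℝ) 1, ∫ s in (0 : ℝ)..x, v s = 0 := by
      intro x hx
      have h3 := h0 ⟨x, hx⟩
      rw [Measure.restrict_restrict measurableSet_Icc, inter_eq_left.2
        (Icc_subset_Icc_right hx.2), integral_Icc_eq_integral_Ioc] at h3
      rw [intervalIntegral.integral_of_le hx.1, h3]
    rw [Lp.eq_zero_iff_ae_eq_zero]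
    have h4 : ∀ᵐ x, x ∈ Icc (0 : ℝ) 1 → v x = 0 := by
      filter_upwards [hii.ae_hasDerivAt_integral, Measure.ae_ne volume (0 : ℝ),
        Measure.ae_ne volume (1 : ℝ)] with x hx hx0 hx1 hmem
      rw [uIcc_of_le zero_le_one] at hx
      have h5 := hx hmem 0 (left_mem_Icc.2 zero_le_one)
      have h6 : (fun x => ∫ s in (0 : ℝ)..x, v s) =ᶠ[𝓝 x] fun _ => 0 := by
        filter_upwards [Icc_mem_nhds (lt_of_le_of_ne hmem.1 hx0.symm)
          (lt_of_le_of_ne hmem.2 hx1)] with y hy using h2 y hy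
      exact (h5.congr_of_eventuallyEq h6.symm).unique (hasDerivAt_const x 0)
    exact (ae_restrict_iff' measurableSet_Icc).2 h4
  rwa [LinearMap.coe_range] at hd

theorem wienerMap_step (hW : IsBrownianMotion W P) (t : unitInterval) (i : Fin n) :
    wienerMap hW (stepFun (t, i)) =ᵐ[P] fun ω => W t ω i := by
  have h := LinearMap.extendOfNorm_eq (f := brownianMap hW) (denseRange_stepMap n)
    ⟨1, fun x => by rw [one_mul, norm_brownianMap]⟩ (Finsupp.single (t, i) 1)
  have h1 : stepMap n (Finsupp.single (t, i) 1) = stepFun (t, i) := by simp [stepMap]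
  rw [h1] at h
  rw [wienerMap, h]
  simpa [brownianMap] using (hW.memLp t i).coeFn_toLp

open Classical in
/-- The Wiener integral `∫₀¹ ⟨f(s), dW_s⟩` of a function `f` with `f ∈ L²([0, 1], ℝⁿ)`,
and `0` otherwise. -/
noncomputable def wienerIntegral (hW : IsBrownianMotion W P) (f : ℝ → E n) : Ω → ℝ :=
  if hf : MemLp f 2 leb then wienerMap hW (hf.toLp f) else 0

/-! ### Measurable seminorms -/

/-- The orthogonal projections onto the finite-dimensional subspaces `V k` converge strongly to the
identity of `H¹`. -/
def IsApproximating (V : ℕ → Submodule ℝ (H1 n)) [∀ k, FiniteDimensional ℝ (V k)] : Prop :=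
  ∀ h : H1 n, Tendsto (fun k => (V k).starProjection h) atTop (𝓝 h)

/-- The `H¹`-valued random variable `𝒫^W = ∑ᵢ (∫₀¹ ⟨hᵢ', dW⟩) hᵢ` that belongs to the orthogonal
projection `𝒫` onto the span of the orthonormal family `h₁, …, h_d`. -/
noncomputable def projW (hW : IsBrownianMotion W P) {d : ℕ} (b : Fin d → H1 n) (ω : Ω) : H1 n :=
  ∑ i, wienerIntegral hW (b i).der ω • b i

/-- `N` is a seminorm (with finite values) on `H¹`. -/
structure IsSeminorm (N : H1 n → ℝ≥0∞) : Prop where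
  lt_top : ∀ h, N h < ∞
  add_le : ∀ h k, N (h + k) ≤ N h + N k
  smul : ∀ (c : ℝ) h, N (c • h) = ‖c‖ₑ * N h

/-- `Nt` is a stochastic extension of `N`: an almost surely finite random variable such that
`N(𝒫ₖ^W) → Nt` in probability for every approximating sequence of projections (and any choice of
orthonormal bases of their ranges), and `P(Nt ≤ ε) > 0` for every `ε > 0`. -/
structure IsStochasticExtension (hW : IsBrownianMotion W P) (N : H1 n → ℝ≥0∞)
    (Nt : Ω → ℝ≥0∞) : Prop where
  aemeasurable : AEMeasurable Nt P
  ae_lt_top : ∀ᵐ ω ∂P, Nt ω < ∞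
  tendsto : ∀ (V : ℕ → Submodule ℝ (H1 n)) [∀ k, FiniteDimensional ℝ (V k)],
    IsApproximating V → ∀ (d : ℕ → ℕ) (b : ∀ k, OrthonormalBasis (Fin (d k)) ℝ (V k)),
    TendstoInMeasure P
      (fun k ω => (N (projW hW (fun i => (b k i : H1 n)) ω)).toReal) atTop
      (fun ω => (Nt ω).toReal)
  pos : ∀ ε : ℝ, 0 < ε → 0 < P {ω | Nt ω ≤ ENNReal.ofReal ε}

/-- `N` is a measurable seminorm on `H¹`. -/
structure IsMeasurableSeminorm (hW : IsBrownianMotion W P) (N : H1 n → ℝ≥0∞) : Prop where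
  isSeminorm : IsSeminorm N
  exists_extension : ∃ Nt : Ω → ℝ≥0∞, IsStochasticExtension hW N Nt

/-- `N` is a measurable norm on `H¹`. -/
structure IsMeasurableNorm (hW : IsBrownianMotion W P) (N : H1 n → ℝ≥0∞) : Prop
    extends IsMeasurableSeminorm hW N where
  eq_zero : ∀ h, N h = 0 → h = 0

/-! ### Hölder norms, the norm `N_g` and the stochastic integral of `g` -/

/-- The Hölder norm `‖f‖_α = sup_t |f(t)| + sup_{s ≠ t} |f(s) - f(t)| / |s - t|^α` of a function on
`[0, 1]` (infinite if `f` is not `α`-Hölder continuous). -/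
noncomputable def holderNorm (α : ℝ) (f : unitInterval → E n) : ℝ≥0∞ :=
  (⨆ t, ‖f t‖ₑ) + ⨆ (s) (t) (_ : s ≠ t), ‖f s - f t‖ₑ / edist s t ^ α

/-- `N_g(h)`: the `α`-Hölder norm of `t ↦ ∫₀ᵗ g(s) h'(s) ds`. -/
noncomputable def Ng (g : ℝ → Matrix (Fin n) (Fin n) ℝ) (α : ℝ) (h : H1 n) : ℝ≥0∞ :=
  holderNorm α fun t : unitInterval =>
    ∫ s in (0 : ℝ)..t, (WithLp.toLp 2 ((g s).mulVec (WithLp.ofLp (h.der s))) : E n)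

/-- `A` is a version with almost surely continuous paths of the process `t ↦ ∫₀ᵗ g(s) dW_s`.
Its `i`-th coordinate at time `t` is the Wiener integral of `1_{[0, t]}` times the `i`-th row
of `g`. -/
structure IsWienerIntegralProcess (hW : IsBrownianMotion W P)
    (g : ℝ → Matrix (Fin n) (Fin n) ℝ) (A : unitInterval → Ω → E n) : Prop where
  eq_integral : ∀ (t : unitInterval) (i : Fin n), (fun ω => A t ω i) =ᵐ[P]
    wienerIntegral hW ((Icc (0 : ℝ) t).indicator fun s => (WithLp.toLp 2 (g s i) : E n))
  continuous_paths : ∀ᵐ ω ∂P, Continuous fun t => A t ω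

end

end WienerSpace

open WienerSpace

namespace WienerSpace

/-! The map `h ↦ h'` identifies `H¹` isometrically with `L²([0, 1], ℝⁿ)` (`derLp`, onto by
`derLp_surjective`). With the kernels `k_{t,i} = 1_{[0,t]} · (row i of g)` (`rowStep`), the path
behind `N_g(h)` has coordinates `⟨k_{t,i}, h'⟩`, while those of `∫₀ᵗ g dW` are the Wiener integrals
`I(k_{t,i})`. Substituting `𝒫^W` for `h` turns `⟨k, h'⟩` into `I(Qk)`, where `Q` is the projection
transported to `L²`. Hence the error between the approximating path and `∫ g dW` is again a process
of Wiener integrals, with kernels `Qk - k` (`pairing_whiteNoise_sub_ae_eq`).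

Convergence is a quantitative Kolmogorov argument. The `α`-Hölder norm of a continuous path
vanishing at `0` is bounded by the `p`-th root of a weighted sum of `p`-th powers of dyadic
increments (`exists_holderNorm_le_dyadicSum`). Its expectation is controlled by the `L²` norms of
the kernel increments, because all moments of a centred Gaussian variable are governed by its
variance (`lintegral_dyadicSum_le`). As `‖k_t - k_s‖ ≤ L √|t - s|` and `Q - 1` is a contraction, the
level-`k` contributions have a geometric majorant independent of the projection once `p (1/2 - α) >
1`. Strong convergence kills each term, so dominated convergence applies (`tendsto_kernelSum`), and
Markov's inequality gives convergence in probability. The same moment bound, without a projection,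
gives a continuous version and its finite Hölder norm.

For small balls, take one projection whose expected error is small. Its finitely many Gaussian
coefficients are independent of the error, because the error kernels are orthogonal to the basis.
Both are small with positive probability, hence so is their sum. Definiteness of `N_g` follows by
differentiating the primitive and inverting `g`. -/

/-! ### Dyadic chaining -/

/-- The dyadic point `i / 2 ^ k` of `[0, 1]`. -/
noncomputable def dyadic (k i : ℕ) : unitInterval :=
  projIcc 0 1 zero_le_one ((i : ℝ) / 2 ^ k)

theorem coe_dyadic {k i : ℕ} (h : i ≤ 2 ^ k) : (dyadic k i : ℝ) = (i : ℝ) / 2 ^ k := by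
  have h1 : (i : ℝ) / 2 ^ k ∈ Icc (0 : ℝ) 1 :=
    ⟨by positivity, (div_le_one (by positivity)).2 (by exact_mod_cast h)⟩
  rw [dyadic, projIcc_of_mem _ h1]

theorem dyadic_succ_two_mul (k i : ℕ) : dyadic (k + 1) (2 * i) = dyadic k i := by
  have : ((2 * i : ℕ) : ℝ) / 2 ^ (k + 1) = (i : ℝ) / 2 ^ k := by
    push_cast
    field_simp
    ring
  rw [dyadic, dyadic, this]

/-- The integer part of `2 ^ k * t`. -/
noncomputable def dyadicIndex (k : ℕ) (t : unitInterval) : ℕ := ⌊2 ^ k * (t : ℝ)⌋₊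

theorem dyadicIndex_le (k : ℕ) (t : unitInterval) : dyadicIndex k t ≤ 2 ^ k := by
  have h : 2 ^ k * (t : ℝ) ≤ ((2 ^ k : ℕ) : ℝ) := by
    push_cast
    exact mul_le_of_le_one_right (by positivity) t.2.2
  exact (Nat.floor_le_floor h).trans_eq (Nat.floor_natCast _)

theorem dyadicIndex_le_mul (k : ℕ) (t : unitInterval) : (dyadicIndex k t : ℝ) ≤ 2 ^ k * t :=
  Nat.floor_le (mul_nonneg (by positivity) t.2.1)

theorem lt_dyadicIndex_add_one (k : ℕ) (t : unitInterval) :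
    2 ^ k * (t : ℝ) < dyadicIndex k t + 1 := Nat.lt_floor_add_one _

/-- The largest dyadic point of level `k` below `t`. -/
noncomputable def dyadicFloor (k : ℕ) (t : unitInterval) : unitInterval :=
  dyadic k (dyadicIndex k t)

theorem tendsto_dyadicFloor (t : unitInterval) :
    Tendsto (fun k => dyadicFloor k t) atTop (𝓝 t) := by
  rw [tendsto_iff_dist_tendsto_zero]
  have h0 : Tendsto (fun k : ℕ => (1 / 2 : ℝ) ^ k) atTop (𝓝 0) :=
    tendsto_pow_atTop_nhds_zero_of_lt_one (by norm_num) (by norm_num)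
  refine squeeze_zero (fun _ => dist_nonneg) (fun k => ?_) h0
  rw [Subtype.dist_eq, Real.dist_eq, dyadicFloor, coe_dyadic (dyadicIndex_le k t), one_div,
    inv_pow]
  have h1 := dyadicIndex_le_mul k t
  have h2 := lt_dyadicIndex_add_one k t
  have hp : (0 : ℝ) < 2 ^ k := by positivity
  have h3 : (dyadicIndex k t : ℝ) / 2 ^ k - t = (dyadicIndex k t - 2 ^ k * t) * (2 ^ k)⁻¹ := by
    field_simp
  rw [h3, abs_mul, abs_of_pos (inv_pos.2 hp)]
  refine mul_le_of_le_one_left (by positivity) ?_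
  rw [abs_le]
  constructor <;> linarith

section

variable {F : Type*} [NormedAddCommGroup F] {f : unitInterval → F} {c r : ℝ}

theorem norm_dyadic_sub_le (hf : ∀ k i, i < 2 ^ k →
    ‖f (dyadic k (i + 1)) - f (dyadic k i)‖ ≤ c * r ^ k) (hc : 0 ≤ c) (hr : 0 ≤ r)
    {k i j : ℕ} (hi : i ≤ 2 ^ k) (hj : j ≤ 2 ^ k) (h1 : i ≤ j + 1) (h2 : j ≤ i + 1) :
    ‖f (dyadic k i) - f (dyadic k j)‖ ≤ c * r ^ k := by
  have h0 : 0 ≤ c * r ^ k := by positivity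
  rcases lt_trichotomy i j with h | h | h
  · obtain rfl : j = i + 1 := by omega
    rw [norm_sub_rev]
    exact hf k i (by omega)
  · subst h
    simpa using h0
  · obtain rfl : i = j + 1 := by omega
    exact hf k j (by omega)

/-- Since `⌊2x⌋` is `2⌊x⌋` or `2⌊x⌋ + 1`, consecutive dyadic floors of `t` coincide or are
neighbours on the finer grid. -/
theorem norm_dyadicFloor_succ_sub_le (hf : ∀ k i, i < 2 ^ k →
    ‖f (dyadic k (i + 1)) - f (dyadic k i)‖ ≤ c * r ^ k) (hc : 0 ≤ c) (hr : 0 ≤ r)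
    (k : ℕ) (t : unitInterval) :
    ‖f (dyadicFloor k t) - f (dyadicFloor (k + 1) t)‖ ≤ c * r ^ (k + 1) := by
  have a1 := dyadicIndex_le_mul k t
  have a2 := lt_dyadicIndex_add_one k t
  have b1 := dyadicIndex_le_mul (k + 1) t
  have b2 := lt_dyadicIndex_add_one (k + 1) t
  rw [pow_succ] at b1 b2
  have e1 : dyadicIndex (k + 1) t < 2 * dyadicIndex k t + 2 := by
    have : (dyadicIndex (k + 1) t : ℝ) < 2 * dyadicIndex k t + 2 := by linarith
    exact_mod_cast this
  have e2 : 2 * dyadicIndex k t < dyadicIndex (k + 1) t + 1 := by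
    have : (2 : ℝ) * dyadicIndex k t < dyadicIndex (k + 1) t + 1 := by linarith
    exact_mod_cast this
  have hk := dyadicIndex_le k t
  rw [dyadicFloor, dyadicFloor, ← dyadic_succ_two_mul]
  exact norm_dyadic_sub_le hf hc hr (by rw [pow_succ]; omega) (dyadicIndex_le _ _)
    (by omega) (by omega)

/-- Times at distance at most `2 ^ (-k)` have level-`k` indices differing by at most one. -/
theorem norm_dyadicFloor_sub_le (hf : ∀ k i, i < 2 ^ k →
    ‖f (dyadic k (i + 1)) - f (dyadic k i)‖ ≤ c * r ^ k) (hc : 0 ≤ c) (hr : 0 ≤ r)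
    {k : ℕ} {s t : unitInterval} (hst : |(s : ℝ) - t| ≤ (1 / 2) ^ k) :
    ‖f (dyadicFloor k s) - f (dyadicFloor k t)‖ ≤ c * r ^ k := by
  have a1 := dyadicIndex_le_mul k s
  have a2 := lt_dyadicIndex_add_one k s
  have b1 := dyadicIndex_le_mul k t
  have b2 := lt_dyadicIndex_add_one k t
  have hp : (0 : ℝ) < 2 ^ k := by positivity
  have h : |2 ^ k * (s : ℝ) - 2 ^ k * t| ≤ 1 := by
    rw [← mul_sub, abs_mul, abs_of_pos hp]
    calc 2 ^ k * |(s : ℝ) - t| ≤ 2 ^ k * (1 / 2) ^ k := by gcongr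
      _ = 1 := by rw [← mul_pow]; norm_num
  rw [abs_le] at h
  have e1 : dyadicIndex k s < dyadicIndex k t + 2 := by
    have : (dyadicIndex k s : ℝ) < dyadicIndex k t + 2 := by linarith [h.1, h.2]
    exact_mod_cast this
  have e2 : dyadicIndex k t < dyadicIndex k s + 2 := by
    have : (dyadicIndex k t : ℝ) < dyadicIndex k s + 2 := by linarith [h.1, h.2]
    exact_mod_cast this
  exact norm_dyadic_sub_le hf hc hr (dyadicIndex_le _ _) (dyadicIndex_le _ _)
    (by omega) (by omega)

/-- If the increments of `f` between neighbouring dyadic points of level `k` are at most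
`c * 2 ^ (-α k)`, then `f` restricted to the dyadic points extends to an `α`-Hölder function. -/
theorem exists_holder_limit [CompleteSpace F] {α : ℝ} (hα : 0 < α) :
    ∃ C : ℝ, 0 ≤ C ∧ ∀ (c : ℝ) (f : unitInterval → F), 0 ≤ c →
      (∀ k i, i < 2 ^ k →
        ‖f (dyadic k (i + 1)) - f (dyadic k i)‖ ≤ c * ((2 : ℝ) ^ (-α)) ^ k) →
      ∃ f' : unitInterval → F, (∀ t, Tendsto (fun k => f (dyadicFloor k t)) atTop (𝓝 (f' t))) ∧
        ∀ s t, ‖f' s - f' t‖ ≤ C * c * |(s : ℝ) - t| ^ α := by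
  set r : ℝ := (2 : ℝ) ^ (-α) with hrdef
  have hr0 : 0 < r := by positivity
  have hr1 : r < 1 := Real.rpow_lt_one_of_one_lt_of_neg (by norm_num) (by linarith)
  have hr1' : 0 < 1 - r := by linarith
  -- One increment at the comparison level plus two geometric tails give `1 + 2 / (1 - r)`; passing
  -- from `2 ^ (-k)` to `|s - t|` costs `2 ^ α`.
  refine ⟨(1 + 2 / (1 - r)) * 2 ^ α, by positivity, fun c f hc hf => ?_⟩
  have hstep : ∀ t k, dist (f (dyadicFloor k t)) (f (dyadicFloor (k + 1) t)) ≤ c * r ^ k := by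
    intro t k
    rw [dist_eq_norm]
    refine (norm_dyadicFloor_succ_sub_le hf hc hr0.le k t).trans ?_
    exact mul_le_mul_of_nonneg_left (pow_le_pow_of_le_one hr0.le hr1.le k.le_succ) hc
  choose f' hf' using fun t =>
    cauchySeq_tendsto_of_complete (cauchySeq_of_le_geometric r c hr1 (hstep t))
  refine ⟨f', hf', fun s t => ?_⟩
  by_cases hst : s = t
  · subst hst
    simp [Real.zero_rpow hα.ne']
  have hpos : 0 < |(s : ℝ) - t| := abs_pos.2 (sub_ne_zero.2 fun h => hst (Subtype.ext h))
  have hle : |(s : ℝ) - t| ≤ 1 := by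
    rw [abs_le]
    constructor <;> linarith [s.2.1, s.2.2, t.2.1, t.2.2]
  -- The comparison level: `2 ^ (-(k + 1)) < |s - t| ≤ 2 ^ (-k)`.
  obtain ⟨k, hk1, hk2⟩ := exists_nat_pow_near_of_lt_one hpos hle
    (by norm_num : (0 : ℝ) < 1 / 2) (by norm_num)
  have hrk : r ^ k ≤ 2 ^ α * |(s : ℝ) - t| ^ α := by
    have h1 : r ^ k = ((1 / 2 : ℝ) ^ k) ^ α := by
      rw [hrdef, ← Real.rpow_natCast, ← Real.rpow_natCast, one_div, ← Real.rpow_neg_one,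
        ← Real.rpow_mul (by norm_num), ← Real.rpow_mul (by norm_num),
        ← Real.rpow_mul (by norm_num)]
      congr 1
      ring
    rw [h1, ← Real.mul_rpow (by norm_num) hpos.le]
    refine Real.rpow_le_rpow (by positivity) ?_ hα.le
    rw [pow_succ] at hk1
    linarith
  have A := dist_le_of_le_geometric_of_tendsto r c hr1 (hstep s) (hf' s) k
  have B := dist_le_of_le_geometric_of_tendsto r c hr1 (hstep t) (hf' t) k
  have D := norm_dyadicFloor_sub_le hf hc hr0.le hk2
  rw [← dist_eq_norm] at D ⊢
  calc dist (f' s) (f' t)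
      ≤ dist (f' s) (f (dyadicFloor k s)) + dist (f (dyadicFloor k s)) (f (dyadicFloor k t))
        + dist (f (dyadicFloor k t)) (f' t) := dist_triangle4 _ _ _ _
    _ ≤ c * r ^ k / (1 - r) + c * r ^ k + c * r ^ k / (1 - r) := by
        gcongr
        rw [dist_comm]
        exact A
    _ = (1 + 2 / (1 - r)) * c * r ^ k := by ring
    _ ≤ (1 + 2 / (1 - r)) * c * (2 ^ α * |(s : ℝ) - t| ^ α) := by gcongr
    _ = (1 + 2 / (1 - r)) * 2 ^ α * c * |(s : ℝ) - t| ^ α := by ring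

end

/-! ### Hölder norms -/

variable {n : ℕ}

/-- The `p`-th power of a Besov-type norm which controls the `α`-Hölder norm. -/
noncomputable def dyadicSum (p : ℕ) (α : ℝ) (f : unitInterval → E n) : ℝ≥0∞ :=
  ∑' k : ℕ, ∑ i ∈ Finset.range (2 ^ k),
    (ENNReal.ofReal (2 ^ α) ^ k * ‖f (dyadic k (i + 1)) - f (dyadic k i)‖ₑ) ^ p

/-- Each term is at most the whole sum; taking `p`-th roots yields the hypothesis of
`exists_holder_limit`. -/
theorem norm_dyadic_sub_le_of_dyadicSum {p : ℕ} (hp : p ≠ 0) (α : ℝ) {f : unitInterval → E n}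
    (hf : dyadicSum p α f ≠ ∞) (k i : ℕ) (hi : i < 2 ^ k) :
    ‖f (dyadic k (i + 1)) - f (dyadic k i)‖ ≤
      (dyadicSum p α f ^ (p⁻¹ : ℝ)).toReal * ((2 : ℝ) ^ (-α)) ^ k := by
  have h1 : (ENNReal.ofReal (2 ^ α) ^ k * ‖f (dyadic k (i + 1)) - f (dyadic k i)‖ₑ) ^ p ≤
      dyadicSum p α f :=
    (Finset.single_le_sum (f := fun i => (ENNReal.ofReal (2 ^ α) ^ k *
      ‖f (dyadic k (i + 1)) - f (dyadic k i)‖ₑ) ^ p) (fun _ _ => zero_le)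
      (Finset.mem_range.2 hi)).trans (ENNReal.le_tsum k)
  have h2 := ENNReal.rpow_le_rpow h1 (by positivity : 0 ≤ (p⁻¹ : ℝ))
  rw [ENNReal.pow_rpow_inv_natCast hp] at h2
  have h3 := ENNReal.toReal_mono (ENNReal.rpow_ne_top_of_nonneg (by positivity) hf) h2
  rw [ENNReal.toReal_mul, ENNReal.toReal_pow, ENNReal.toReal_ofReal (by positivity),
    toReal_enorm] at h3
  rw [Real.rpow_neg (by norm_num), inv_pow, ← div_eq_mul_inv, le_div_iff₀ (by positivity),
    mul_comm]
  exact h3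

theorem holderNorm_le {α : ℝ} {f : unitInterval → E n} {c : ℝ} (h0 : f 0 = 0)
    (hα : 0 < α) (hf : ∀ s t, ‖f s - f t‖ ≤ c * |(s : ℝ) - t| ^ α) :
    holderNorm α f ≤ 2 * ENNReal.ofReal c := by
  have hc : 0 ≤ c := by
    have := (norm_nonneg _).trans (hf 0 1)
    simpa using this
  rw [holderNorm, two_mul]
  refine add_le_add (iSup_le fun t => ?_) (iSup_le fun s => iSup_le fun t => iSup_le fun hst => ?_)
  · have h1 := hf t 0
    rw [h0, sub_zero] at h1
    rw [← ofReal_norm]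
    refine ENNReal.ofReal_le_ofReal (h1.trans (mul_le_of_le_one_right hc ?_))
    refine Real.rpow_le_one (abs_nonneg _) ?_ hα.le
    rw [abs_le]
    constructor <;> simp <;> linarith [t.2.1, t.2.2]
  · refine ENNReal.div_le_of_le_mul ?_
    rw [edist_dist, Subtype.dist_eq, Real.dist_eq, ENNReal.ofReal_rpow_of_nonneg (abs_nonneg _)
      hα.le, ← ENNReal.ofReal_mul hc, ← ofReal_norm]
    exact ENNReal.ofReal_le_ofReal (hf s t)

/-- Here `f` may be discontinuous away from the dyadic points: this is the regularisation that
produces continuous versions. -/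
theorem exists_continuous_limit {p : ℕ} (hp : p ≠ 0) {α : ℝ} (hα : 0 < α)
    {f : unitInterval → E n} (hf : dyadicSum p α f ≠ ∞) :
    ∃ f' : unitInterval → E n, Continuous f' ∧
      ∀ t, Tendsto (fun k => f (dyadicFloor k t)) atTop (𝓝 (f' t)) := by
  obtain ⟨C, -, hC⟩ := exists_holder_limit (F := E n) hα
  obtain ⟨f', h1, h2⟩ := hC (dyadicSum p α f ^ (p⁻¹ : ℝ)).toReal f ENNReal.toReal_nonneg
    (norm_dyadic_sub_le_of_dyadicSum hp α hf)
  refine ⟨f', ?_, h1⟩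
  generalize C * (dyadicSum p α f ^ (p⁻¹ : ℝ)).toReal = c at h2
  rw [continuous_iff_continuousAt]
  intro t
  rw [ContinuousAt, tendsto_iff_norm_sub_tendsto_zero]
  refine squeeze_zero (fun _ => norm_nonneg _) (fun s => h2 s t) ?_
  have hcont : Continuous fun s : unitInterval => c * |(s : ℝ) - t| ^ α :=
    continuous_const.mul (Continuous.rpow_const (by fun_prop) fun _ => Or.inr hα.le)
  have h3 := hcont.tendsto t
  rw [sub_self, abs_zero, Real.zero_rpow hα.ne', mul_zero] at h3
  exact h3

/-- By continuity, the dyadic limit of `exists_holder_limit` is `f` itself. The constant depends on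
neither `p` nor `f`. -/
theorem exists_holderNorm_le_dyadicSum (n : ℕ) {α : ℝ} (hα : 0 < α) :
    ∃ C : ℝ≥0, ∀ p : ℕ, p ≠ 0 → ∀ f : unitInterval → E n, Continuous f → f 0 = 0 →
      holderNorm α f ≤ C * dyadicSum p α f ^ (p⁻¹ : ℝ) := by
  obtain ⟨C, hC, H⟩ := exists_holder_limit (F := E n) hα
  -- The `+ 1` makes the constant nonzero, so that the bound is `∞` when the sum diverges, rather
  -- than `0 * ∞ = 0`.
  refine ⟨2 * (C.toNNReal + 1), fun p hp f hf h0 => ?_⟩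
  by_cases htop : dyadicSum p α f = ∞
  · rw [htop, ENNReal.top_rpow_of_pos (by positivity), ENNReal.mul_top]
    · exact le_top
    · simp
  obtain ⟨f', hf', hh⟩ := H (dyadicSum p α f ^ (p⁻¹ : ℝ)).toReal f ENNReal.toReal_nonneg
    (norm_dyadic_sub_le_of_dyadicSum hp α htop)
  have he : f' = f := by
    funext t
    exact tendsto_nhds_unique (hf' t) ((hf.tendsto t).comp (tendsto_dyadicFloor t))
  rw [he] at hh
  refine (holderNorm_le h0 hα hh).trans ?_
  rw [ENNReal.ofReal_mul hC, ENNReal.ofReal_toReal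
    (ENNReal.rpow_ne_top_of_nonneg (by positivity) htop), ← mul_assoc]
  gcongr
  push_cast
  gcongr
  exact le_self_add

theorem holderNorm_add_le (α : ℝ) (f g : unitInterval → E n) :
    holderNorm α (f + g) ≤ holderNorm α f + holderNorm α g := by
  simp only [holderNorm]
  rw [add_add_add_comm]
  refine add_le_add (iSup_le fun t => ?_) (iSup_le fun s => iSup_le fun t => iSup_le fun hst => ?_)
  · exact (enorm_add_le _ _).trans (add_le_add (le_iSup (fun t => ‖f t‖ₑ) t)
      (le_iSup (fun t => ‖g t‖ₑ) t))
  · refine le_trans ?_ (add_le_add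
      (le_iSup_of_le s (le_iSup_of_le t (le_iSup_of_le hst le_rfl)))
      (le_iSup_of_le s (le_iSup_of_le t (le_iSup_of_le hst le_rfl))))
    rw [← ENNReal.add_div]
    gcongr
    rw [Pi.add_apply, Pi.add_apply, add_sub_add_comm]
    exact enorm_add_le _ _

theorem holderNorm_smul (α c : ℝ) (f : unitInterval → E n) :
    holderNorm α (c • f) = ‖c‖ₑ * holderNorm α f := by
  simp only [holderNorm, mul_add, ENNReal.mul_iSup, Pi.smul_apply, ← smul_sub, enorm_smul,
    mul_div_assoc]

theorem holderNorm_neg (α : ℝ) (f : unitInterval → E n) :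
    holderNorm α (-f) = holderNorm α f := by
  have := holderNorm_smul α (-1) f
  simpa using this

theorem holderNorm_sub_comm (α : ℝ) (f g : unitInterval → E n) :
    holderNorm α (f - g) = holderNorm α (g - f) := by
  rw [← holderNorm_neg, neg_sub]

theorem holderNorm_le_add_sub (α : ℝ) (f g : unitInterval → E n) :
    holderNorm α f ≤ holderNorm α g + holderNorm α (f - g) := by
  have := holderNorm_add_le α g (f - g)
  rwa [add_sub_cancel] at this

/-- Reverse triangle inequality. Finiteness of both norms matters because `toReal` sends `∞` to `0`.
-/
theorem edist_toReal_holderNorm_le (α : ℝ) {f g : unitInterval → E n} (hf : holderNorm α f ≠ ∞)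
    (hg : holderNorm α g ≠ ∞) :
    edist (holderNorm α f).toReal (holderNorm α g).toReal ≤ holderNorm α (f - g) := by
  by_cases hfg : holderNorm α (f - g) = ∞
  · simp [hfg]
  rw [edist_dist, Real.dist_eq]
  refine ENNReal.ofReal_le_of_le_toReal ?_
  have h1 := ENNReal.toReal_mono (ENNReal.add_ne_top.2 ⟨hg, hfg⟩) (holderNorm_le_add_sub α f g)
  have h2 := ENNReal.toReal_mono (ENNReal.add_ne_top.2 ⟨hf, holderNorm_sub_comm α f g ▸ hfg⟩)
    (holderNorm_le_add_sub α g f)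
  rw [ENNReal.toReal_add hg hfg] at h1
  rw [holderNorm_sub_comm α g f, ENNReal.toReal_add hf hfg] at h2
  rw [abs_le]
  constructor <;> linarith

/-- For continuous functions, the suprema in the Hölder norm may be taken over countable sets. -/
theorem exists_holderNorm_eq_iSup_seq (n : ℕ) (α : ℝ) :
    ∃ (u : ℕ → unitInterval) (v : ℕ → unitInterval × unitInterval), ∀ f : unitInterval → E n,
      Continuous f → holderNorm α f = (⨆ j, ‖f (u j)‖ₑ) +
        ⨆ j, ‖f (v j).1 - f (v j).2‖ₑ / edist (v j).1 (v j).2 ^ α := by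
  -- The difference quotient is continuous off the diagonal, so a dense sequence of that subspace
  -- suffices for the second supremum.
  let S : Type := {x : unitInterval × unitInterval // x.1 ≠ x.2}
  have : Nonempty S := ⟨⟨(0, 1), by simp⟩⟩
  refine ⟨TopologicalSpace.denseSeq unitInterval,
    fun j => (TopologicalSpace.denseSeq S j).1, fun f hf => ?_⟩
  rw [holderNorm]
  congr 1
  · refine le_antisymm (iSup_le fun t => ?_) (iSup_le fun j => le_iSup (fun t => ‖f t‖ₑ) _)
    have hcl : IsClosed {t | ‖f t‖ₑ ≤ ⨆ j, ‖f (TopologicalSpace.denseSeq unitInterval j)‖ₑ} :=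
      isClosed_le (by fun_prop) continuous_const
    exact (TopologicalSpace.denseRange_denseSeq unitInterval).induction_on t hcl
      fun j => le_iSup (fun j => ‖f (TopologicalSpace.denseSeq unitInterval j)‖ₑ) j
  · refine le_antisymm (iSup_le fun s => iSup_le fun t => iSup_le fun hst => ?_)
      (iSup_le fun j => ?_)
    · have hcont : Continuous fun x : S => ‖f x.1.1 - f x.1.2‖ₑ / edist x.1.1 x.1.2 ^ α := by
        rw [continuous_iff_continuousAt]
        intro x
        have hx : edist x.1.1 x.1.2 ≠ 0 := by simpa using x.2
        refine ENNReal.Tendsto.div (Continuous.tendsto (by fun_prop) x) (Or.inr ?_)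
          (Tendsto.comp (ENNReal.continuous_rpow_const.tendsto _)
            (Continuous.tendsto (by fun_prop) x)) (Or.inr ?_)
        · exact (ENNReal.rpow_pos (pos_iff_ne_zero.2 hx) (edist_ne_top _ _)).ne'
        · exact enorm_ne_top
      have hcl : IsClosed {x : S | ‖f x.1.1 - f x.1.2‖ₑ / edist x.1.1 x.1.2 ^ α ≤
          ⨆ j, ‖f (TopologicalSpace.denseSeq S j).1.1 - f (TopologicalSpace.denseSeq S j).1.2‖ₑ /
            edist (TopologicalSpace.denseSeq S j).1.1 (TopologicalSpace.denseSeq S j).1.2 ^ α} :=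
        isClosed_le hcont continuous_const
      exact (TopologicalSpace.denseRange_denseSeq S).induction_on
        (p := fun x : S => ‖f x.1.1 - f x.1.2‖ₑ / edist x.1.1 x.1.2 ^ α ≤ _) ⟨(s, t), hst⟩ hcl
        fun j => le_iSup (fun j => ‖f (TopologicalSpace.denseSeq S j).1.1 -
          f (TopologicalSpace.denseSeq S j).1.2‖ₑ /
            edist (TopologicalSpace.denseSeq S j).1.1 (TopologicalSpace.denseSeq S j).1.2 ^ α) j
    · exact le_iSup_of_le _ (le_iSup_of_le _ (le_iSup_of_le
        (TopologicalSpace.denseSeq S j).2 le_rfl))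

/-! ### The Wiener integral is an isonormal Gaussian process -/

section

variable {Ω : Type*} [MeasurableSpace Ω] {n : ℕ} {W : unitInterval → Ω → E n} {P : Measure Ω}

theorem wienerMap_stepMap (hW : IsBrownianMotion W P) (x : (unitInterval × Fin n) →₀ ℝ) :
    wienerMap hW (stepMap n x) = brownianMap hW x :=
  LinearMap.extendOfNorm_eq (denseRange_stepMap n)
    ⟨1, fun x => by rw [one_mul, norm_brownianMap]⟩ x

theorem norm_wienerMap (hW : IsBrownianMotion W P) (f : Lp (E n) 2 leb) :
    ‖wienerMap hW f‖ = ‖f‖ := by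
  refine (denseRange_stepMap n).induction_on (p := fun f => ‖wienerMap hW f‖ = ‖f‖) f
    (isClosed_eq (by fun_prop) (by fun_prop)) fun x => ?_
  rw [wienerMap_stepMap, norm_brownianMap]

theorem inner_wienerMap (hW : IsBrownianMotion W P) (f g : Lp (E n) 2 leb) :
    ⟪wienerMap hW f, wienerMap hW g⟫_ℝ = ⟪f, g⟫_ℝ := by
  exact LinearIsometry.inner_map_map
    ⟨(wienerMap hW : Lp (E n) 2 leb →ₗ[ℝ] Lp ℝ 2 P), norm_wienerMap hW⟩ f g

theorem brownianMap_ae_eq (hW : IsBrownianMotion W P) (x : (unitInterval × Fin n) →₀ ℝ) :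
    brownianMap hW x =ᵐ[P] fun ω => ∑ p ∈ x.support, x p * W p.1 ω p.2 := by
  rw [brownianMap, Finsupp.linearCombination_apply, Finsupp.sum]
  refine (Lp.coeFn_finsetSum _ _).trans ?_
  have : ∀ᵐ ω ∂P, ∀ p ∈ x.support,
      (x p • (hW.memLp p.1 p.2).toLp (fun ω => W p.1 ω p.2) : Lp ℝ 2 P) ω =
        x p * W p.1 ω p.2 := by
    refine (ae_ball_iff x.support.countable_toSet).2 fun p _ => ?_
    filter_upwards [Lp.coeFn_smul (x p) ((hW.memLp p.1 p.2).toLp (fun ω => W p.1 ω p.2)),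
      (hW.memLp p.1 p.2).coeFn_toLp] with ω h1 h2
    rw [h1, Pi.smul_apply, h2, smul_eq_mul]
  filter_upwards [this] with ω h
  rw [Finset.sum_apply]
  exact Finset.sum_congr rfl fun p hp => h p hp

theorem hasGaussianLaw_brownianMap (hW : IsBrownianMotion W P)
    (x : (unitInterval × Fin n) →₀ ℝ) : HasGaussianLaw (brownianMap hW x) P := by
  refine HasGaussianLaw.congr ?_ (brownianMap_ae_eq hW x).symm
  have h1 : IsGaussianProcess (fun (p : unitInterval × Fin n) ω => x p * W p.1 ω p.2) P :=
    hW.gaussian.of_isGaussianProcess fun p => ⟨{p.1}, x p • (EuclideanSpace.proj (𝕜 := ℝ) p.2 ∘L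
      ContinuousLinearMap.proj ⟨p.1, Finset.mem_singleton_self _⟩), fun ω => by simp⟩
  exact h1.hasGaussianLaw_fun_sum

theorem integral_brownianMap (hW : IsBrownianMotion W P) [IsProbabilityMeasure P]
    (x : (unitInterval × Fin n) →₀ ℝ) : ∫ ω, brownianMap hW x ω ∂P = 0 := by
  rw [integral_congr_ae (brownianMap_ae_eq hW x), integral_finsetSum]
  · refine Finset.sum_eq_zero fun p _ => ?_
    rw [integral_const_mul, hW.mean, mul_zero]
  · exact fun p _ => ((hW.memLp p.1 p.2).integrable one_le_two).const_mul _

variable [IsProbabilityMeasure P]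

/-- On step functions the integral is a centred Gaussian variable with variance `‖f‖²`. Both sides
are continuous in `f`: on the left, `|e^{iy} - e^{iz}| ≤ |y - z|` and `L¹ ≤ L²` on a probability
space. Density of step functions concludes. -/
theorem charFun_map_one (hW : IsBrownianMotion W P) (f : Lp (E n) 2 leb) :
    charFun (P.map (wienerMap hW f)) 1 = Complex.exp (-(‖f‖ ^ 2 / 2 : ℝ)) := by
  have hae : ∀ Y : Lp ℝ 2 P, AEMeasurable Y P := fun Y => (Lp.aestronglyMeasurable Y).aemeasurable
  have hcf : ∀ Y : Lp ℝ 2 P, charFun (P.map Y) 1 = ∫ ω, Complex.exp (Y ω * Complex.I) ∂P := by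
    intro Y
    rw [charFun_apply_real, integral_map (hae Y) (by fun_prop)]
    simp
  have hint : ∀ Y : Lp ℝ 2 P, Integrable (fun ω => Complex.exp (Y ω * Complex.I)) P := by
    intro Y
    refine Integrable.of_bound (C := 1) ?_ (Eventually.of_forall fun ω => ?_)
    · have := hae Y
      exact AEMeasurable.aestronglyMeasurable (by fun_prop)
    · rw [Complex.norm_exp_ofReal_mul_I]
  have hlip : LipschitzWith 1 fun Y : Lp ℝ 2 P => charFun (P.map Y) 1 := by
    refine LipschitzWith.of_dist_le_mul fun Y Z => ?_
    rw [dist_eq_norm, hcf, hcf, ← integral_sub (hint Y) (hint Z), NNReal.coe_one, one_mul,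
      dist_eq_norm]
    have hYZ : Integrable (Y - Z : Lp ℝ 2 P) P := (Lp.memLp (Y - Z)).integrable one_le_two
    calc ‖∫ ω, (Complex.exp (Y ω * Complex.I) - Complex.exp (Z ω * Complex.I)) ∂P‖
        ≤ ∫ ω, ‖(Y - Z : Lp ℝ 2 P) ω‖ ∂P := by
          refine norm_integral_le_of_norm_le hYZ.norm ?_
          filter_upwards [Lp.coeFn_sub Y Z] with ω hω
          rw [hω, Pi.sub_apply]
          have h1 := Real.norm_exp_I_mul_ofReal_sub_one_le (x := Y ω - Z ω)
          have h2 : Complex.exp (Y ω * Complex.I) - Complex.exp (Z ω * Complex.I) =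
              Complex.exp (Z ω * Complex.I) *
                (Complex.exp (Complex.I * ((Y ω - Z ω : ℝ) : ℂ)) - 1) := by
            rw [mul_sub, ← Complex.exp_add, mul_one]
            congr 2
            push_cast
            ring
          rw [h2, norm_mul, Complex.norm_exp_ofReal_mul_I, one_mul]
          exact h1
      _ ≤ ‖Y - Z‖ := by
          rw [integral_norm_eq_lintegral_enorm hYZ.1, Lp.norm_def, ← eLpNorm_one_eq_lintegral_enorm]
          exact ENNReal.toReal_mono (Lp.eLpNorm_ne_top _)
            (eLpNorm_le_eLpNorm_of_exponent_le one_le_two hYZ.1)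
  refine (denseRange_stepMap n).induction_on
    (p := fun f => charFun (P.map (wienerMap hW f)) 1 = Complex.exp (-(‖f‖ ^ 2 / 2 : ℝ))) f
    (isClosed_eq (hlip.continuous.comp (wienerMap hW).continuous) (by fun_prop)) fun x => ?_
  rw [wienerMap_stepMap, (hasGaussianLaw_brownianMap hW x).map_eq_gaussianReal,
    integral_brownianMap, charFun_gaussianReal, variance_of_integral_eq_zero (hae _)
      (integral_brownianMap hW x), ← norm_brownianMap hW]
  have h1 : ∫ ω, (brownianMap hW x) ω ^ 2 ∂P = ‖brownianMap hW x‖ ^ 2 := by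
    rw [← real_inner_self_eq_norm_sq, L2.inner_def]
    simp [pow_two]
  rw [h1, Real.coe_toNNReal _ (by positivity)]
  congr 1
  push_cast
  ring

/-- The characteristic function at `t` is the one of the integral of `t • f` at `1`. -/
theorem map_wienerMap (hW : IsBrownianMotion W P) (f : Lp (E n) 2 leb) :
    P.map (wienerMap hW f) = gaussianReal 0 (‖f‖₊ ^ 2) := by
  have hae : ∀ Y : Lp ℝ 2 P, AEMeasurable Y P := fun Y => (Lp.aestronglyMeasurable Y).aemeasurable
  have := P.isProbabilityMeasure_map (hae (wienerMap hW f))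
  refine Measure.ext_of_charFun (funext fun t => ?_)
  have h1 := charFun_map_one hW (t • f)
  have h2 : P.map (wienerMap hW (t • f)) = P.map (fun ω => t * wienerMap hW f ω) := by
    refine Measure.map_congr ?_
    rw [map_smul]
    filter_upwards [Lp.coeFn_smul t (wienerMap hW f)] with ω hω
    rw [hω]
    rfl
  have h3 : charFun (P.map (fun ω => t * wienerMap hW f ω)) 1 =
      charFun (P.map (wienerMap hW f)) t := by
    rw [charFun_apply_real, charFun_apply_real, integral_map (hae _) (by fun_prop),
      integral_map ((hae _).const_mul t) (by fun_prop)]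
    simp
  rw [← h3, ← h2, h1, charFun_gaussianReal, norm_smul]
  congr 1
  rw [mul_pow, Real.norm_eq_abs, sq_abs]
  push_cast
  ring

theorem integral_wienerMap (hW : IsBrownianMotion W P) (f : Lp (E n) 2 leb) :
    ∫ ω, wienerMap hW f ω ∂P = 0 := by
  have h := integral_id_gaussianReal (μ := 0) (v := ‖f‖₊ ^ 2)
  rwa [← map_wienerMap hW f, integral_map (Lp.aestronglyMeasurable _).aemeasurable
    (by fun_prop)] at h

theorem covariance_wienerMap (hW : IsBrownianMotion W P) (f g : Lp (E n) 2 leb) :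
    cov[wienerMap hW f, wienerMap hW g; P] = ⟪f, g⟫_ℝ := by
  rw [covariance_eq_sub (Lp.memLp _) (Lp.memLp _), integral_wienerMap, zero_mul, sub_zero,
    ← inner_wienerMap hW, L2.inner_def]
  simp [mul_comm]

theorem isGaussianProcess_wienerMap (hW : IsBrownianMotion W P) :
    IsGaussianProcess (fun (f : Lp (E n) 2 leb) ω => wienerMap hW f ω) P where
  hasGaussianLaw J := by
    classical
    have hm : AEMeasurable (fun ω => J.restrict (fun f => wienerMap hW f ω)) P :=
      aemeasurable_pi_iff.2 fun f => (Lp.aestronglyMeasurable (wienerMap hW f.1)).aemeasurable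
    refine ⟨⟨fun L => ?_⟩⟩
    -- A linear functional of finitely many Wiener integrals is the Wiener integral of a linear
    -- combination, whose law is already known to be Gaussian.
    have h1 : L ∘ (fun ω => J.restrict (fun f => wienerMap hW f ω)) =ᵐ[P]
        wienerMap hW (∑ f : J, L (Pi.single f 1) • (f : Lp (E n) 2 leb)) := by
      rw [map_sum]
      simp only [map_smul]
      have h2 : ∀ᵐ ω ∂P, ∀ f : J, (L (Pi.single f 1) • wienerMap hW f : Lp ℝ 2 P) ω =
          L (Pi.single f 1) * wienerMap hW f ω := by
        refine ae_all_iff.2 fun f => ?_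
        filter_upwards [Lp.coeFn_smul (L (Pi.single f 1)) (wienerMap hW f)] with ω hω
        rw [hω]
        rfl
      filter_upwards [h2, Lp.coeFn_finsetSum Finset.univ
        (fun f : J => (L (Pi.single f 1) • wienerMap hW f : Lp ℝ 2 P))] with ω hω hs
      rw [hs, Finset.sum_apply, Function.comp_apply]
      simp only [hω]
      rw [← L.sum_comp_single]
      refine Finset.sum_congr rfl fun f _ => ?_
      have : (Pi.single f (wienerMap hW f.1 ω) : J → ℝ) =
          wienerMap hW f.1 ω • Pi.single f (1 : ℝ) := by
        rw [← Pi.single_smul, smul_eq_mul, mul_one]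
      simp only [ContinuousLinearMap.comp_apply, ContinuousLinearMap.single_apply,
        Finset.restrict]
      rw [this, map_smul, smul_eq_mul, mul_comm]
    have h3 : (P.map (fun ω => J.restrict (fun f => wienerMap hW f ω))).map L =
        gaussianReal 0 (‖∑ f : J, L (Pi.single f 1) • (f : Lp (E n) 2 leb)‖₊ ^ 2) := by
      rw [AEMeasurable.map_map_of_aemeasurable (by fun_prop) hm, Measure.map_congr h1,
        map_wienerMap]
    have h4 := integral_id_gaussianReal (μ := 0)
      (v := ‖∑ f : J, L (Pi.single f 1) • (f : Lp (E n) 2 leb)‖₊ ^ 2)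
    have h5 := variance_id_gaussianReal (μ := 0)
      (v := ‖∑ f : J, L (Pi.single f 1) • (f : Lp (E n) 2 leb)‖₊ ^ 2)
    rw [← h3, integral_map (by fun_prop) (by fun_prop)] at h4
    rw [← h3, variance_map (by fun_prop) (by fun_prop)] at h5
    rw [h3]
    congr 1
    · exact h4.symm
    · rw [← Real.toNNReal_coe (r := ‖∑ f : J, L (Pi.single f 1) • (f : Lp (E n) 2 leb)‖₊ ^ 2)]
      congr 1
      exact h5.symm

/-- The families of Wiener integrals of two orthogonal families are independent. -/
theorem indepFun_wienerMap (hW : IsBrownianMotion W P) {S T : Type*} (u : S → Lp (E n) 2 leb)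
    (v : T → Lp (E n) 2 leb) (huv : ∀ s t, ⟪u s, v t⟫_ℝ = 0) :
    IndepFun (fun ω s => wienerMap hW (u s) ω) (fun ω t => wienerMap hW (v t) ω) P := by
  refine IsGaussianProcess.indepFun_of_covariance_eq_zero ?_
    (fun s => (Lp.aestronglyMeasurable _).aemeasurable)
    (fun t => (Lp.aestronglyMeasurable _).aemeasurable) fun s t => ?_
  · have := (isGaussianProcess_wienerMap hW).comp_right (Sum.elim u v)
    have he : Sum.elim (fun s ω => wienerMap hW (u s) ω) (fun t ω => wienerMap hW (v t) ω) =
        (fun (f : Lp (E n) 2 leb) ω => wienerMap hW f ω) ∘ Sum.elim u v := by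
      funext x
      cases x <;> rfl
    rwa [he]
  · rw [covariance_wienerMap, huv]

theorem iIndepFun_wienerMap (hW : IsBrownianMotion W P) {d : ℕ} {b : Fin d → Lp (E n) 2 leb}
    (hb : Orthonormal ℝ b) : iIndepFun (fun j ω => wienerMap hW (b j) ω) P := by
  classical
  refine HasGaussianLaw.iIndepFun_of_covariance_eq_zero ?_ fun i j hij => ?_
  · have := (isGaussianProcess_wienerMap hW).hasGaussianLaw (Finset.univ.image b)
    exact this.map_fun (F := Fin d → ℝ) (ContinuousLinearMap.pi fun j =>
      ContinuousLinearMap.proj ⟨b j, Finset.mem_image_of_mem _ (Finset.mem_univ _)⟩)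
  · rw [covariance_wienerMap, hb.2 hij]

theorem measure_abs_wienerMap_le_pos (hW : IsBrownianMotion W P) {f : Lp (E n) 2 leb}
    {δ : ℝ} (hδ : 0 < δ) : 0 < P {ω | |wienerMap hW f ω| ≤ δ} := by
  have hm : MeasurableSet {x : ℝ | |x| ≤ δ} := measurableSet_le (by fun_prop) (by fun_prop)
  have h1 : P {ω | |wienerMap hW f ω| ≤ δ} = gaussianReal 0 (‖f‖₊ ^ 2) {x | |x| ≤ δ} := by
    rw [← map_wienerMap hW f,
      Measure.map_apply_of_aemeasurable (Lp.aestronglyMeasurable _).aemeasurable hm]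
    rfl
  rw [h1]
  by_cases hv : ‖f‖₊ ^ 2 = 0
  · rw [hv, gaussianReal_zero_var, Measure.dirac_apply' _ hm]
    simp [hδ.le]
  · rw [pos_iff_ne_zero]
    intro h0
    -- Lebesgue measure is absolutely continuous with respect to a nondegenerate Gaussian, so a null
    -- interval would have length zero.
    have h2 := gaussianReal_absolutelyContinuous' 0 hv h0
    have h3 : Icc (-δ) δ ⊆ {x | |x| ≤ δ} := fun x hx => abs_le.2 hx
    have h4 := measure_mono_null h3 h2
    rw [Real.volume_Icc, ENNReal.ofReal_eq_zero] at h4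
    linarith

theorem measure_forall_abs_wienerMap_le_pos (hW : IsBrownianMotion W P) {d : ℕ}
    {b : Fin d → Lp (E n) 2 leb} (hb : Orthonormal ℝ b) {δ : ℝ} (hδ : 0 < δ) :
    0 < P {ω | ∀ j, |wienerMap hW (b j) ω| ≤ δ} := by
  have h := (iIndepFun_wienerMap hW hb).measure_inter_preimage_eq_mul Finset.univ
    (sets := fun _ => {x : ℝ | |x| ≤ δ})
    (fun _ _ => measurableSet_le (by fun_prop) (by fun_prop))
  have h2 : {ω | ∀ j, |wienerMap hW (b j) ω| ≤ δ} = ⋂ j ∈ (Finset.univ : Finset (Fin d)),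
      (fun ω => wienerMap hW (b j) ω) ⁻¹' {x : ℝ | |x| ≤ δ} := by
    ext ω
    simp
  rw [h2, h, pos_iff_ne_zero, Finset.prod_ne_zero_iff]
  exact fun j _ => (measure_abs_wienerMap_le_pos hW hδ).ne'

/-- The `L^p` norm of a standard normal random variable. -/
noncomputable def gaussNorm (p : ℕ) : ℝ≥0∞ := eLpNorm id p (gaussianReal 0 1)

theorem gaussNorm_ne_top (p : ℕ) : gaussNorm p ≠ ∞ :=
  (memLp_id_gaussianReal' p (ENNReal.natCast_ne_top p)).eLpNorm_ne_top

/-- The law is that of `‖f‖` times a standard normal variable; this turns `L²` bounds on kernels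
into `L^p` bounds for arbitrarily large `p`. -/
theorem eLpNorm_wienerMap (hW : IsBrownianMotion W P) (p : ℕ) (f : Lp (E n) 2 leb) :
    eLpNorm (wienerMap hW f) p P = ‖f‖ₑ * gaussNorm p := by
  have h1 : eLpNorm (wienerMap hW f) p P = eLpNorm id p (P.map (wienerMap hW f)) := by
    rw [eLpNorm_map_measure (by fun_prop) (Lp.aestronglyMeasurable _).aemeasurable]
    rfl
  have h2 : gaussianReal 0 (‖f‖₊ ^ 2) = (gaussianReal 0 1).map (‖f‖ * ·) := by
    rw [gaussianReal_map_const_mul]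
    congr 1
    · simp
    · ext
      simp
  rw [h1, map_wienerMap, h2, eLpNorm_map_measure (by fun_prop) (by fun_prop), gaussNorm]
  have h3 : id ∘ (fun x => ‖f‖ * x) = ‖f‖ • (id : ℝ → ℝ) := rfl
  rw [h3, eLpNorm_const_smul, enorm_norm]

end

/-! ### Moments of dyadic sums of Gaussian processes -/

section

variable {Ω : Type*} [MeasurableSpace Ω] {n : ℕ} {W : unitInterval → Ω → E n} {P : Measure Ω}

theorem aemeasurable_of_coord {X : Ω → E n} (h : ∀ i, AEMeasurable (fun ω => X ω i) P) :
    AEMeasurable X P := by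
  have h1 : AEMeasurable (fun ω i => X ω i) P := aemeasurable_pi_iff.2 h
  exact (WithLp.measurable_toLp 2 (Fin n → ℝ)).comp_aemeasurable h1

theorem enorm_le_sum_coord (x : E n) : ‖x‖ₑ ≤ ∑ i, ‖x i‖ₑ := by
  have h1 : x = ∑ i, EuclideanSpace.single i (x i) := by
    ext j
    simp [Finset.sum_apply, Pi.single_apply]
  calc ‖x‖ₑ = ‖∑ i, EuclideanSpace.single i (x i)‖ₑ := by rw [← h1]
    _ ≤ ∑ i, ‖(EuclideanSpace.single i (x i) : E n)‖ₑ := enorm_sum_le _ _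
    _ = ∑ i, ‖x i‖ₑ := by
      refine Finset.sum_congr rfl fun i _ => ?_
      rw [← ofReal_norm, ← ofReal_norm, PiLp.norm_single]

theorem aemeasurable_of_ae_eq_wienerMap {hW : IsBrownianMotion W P}
    {D : unitInterval → Ω → E n} {ψ : unitInterval → Fin n → Lp (E n) 2 leb}
    (hD : ∀ t i, (fun ω => D t ω i) =ᵐ[P] wienerMap hW (ψ t i)) (t : unitInterval) :
    AEMeasurable (D t) P :=
  aemeasurable_of_coord fun i => (Lp.aestronglyMeasurable _).aemeasurable.congr (hD t i).symm

theorem aemeasurable_dyadicSum {D : unitInterval → Ω → E n} (hD : ∀ t, AEMeasurable (D t) P)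
    (p : ℕ) (α : ℝ) : AEMeasurable (fun ω => dyadicSum p α fun t => D t ω) P := by
  unfold dyadicSum
  refine AEMeasurable.tsum fun k => Finset.aemeasurable_fun_sum _ fun i _ => ?_
  exact (((hD _).sub (hD _)).enorm.const_mul _).pow_const _

/-- The dyadic sum of the `L²` kernels of a Gaussian process. -/
noncomputable def kernelSum (p : ℕ) (α : ℝ) (ψ : unitInterval → Fin n → Lp (E n) 2 leb) : ℝ≥0∞ :=
  ∑' k : ℕ, ∑ i ∈ Finset.range (2 ^ k), (ENNReal.ofReal (2 ^ α) ^ k *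
    ∑ c, ‖ψ (dyadic k (i + 1)) c - ψ (dyadic k i) c‖ₑ) ^ p

variable [IsProbabilityMeasure P]

theorem eLpNorm_sub_le {hW : IsBrownianMotion W P}
    {D : unitInterval → Ω → E n} {ψ : unitInterval → Fin n → Lp (E n) 2 leb}
    (hD : ∀ t i, (fun ω => D t ω i) =ᵐ[P] wienerMap hW (ψ t i)) {p : ℕ} (hp : p ≠ 0)
    (s t : unitInterval) :
    eLpNorm (fun ω => D t ω - D s ω) p P ≤ gaussNorm p * ∑ i, ‖ψ t i - ψ s i‖ₑ := by
  calc eLpNorm (fun ω => D t ω - D s ω) p P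
      ≤ eLpNorm (∑ i, fun ω => ‖(wienerMap hW (ψ t i - ψ s i)) ω‖) p P := by
        refine eLpNorm_mono_ae ?_
        have h : ∀ᵐ ω ∂P, ∀ i, wienerMap hW (ψ t i - ψ s i) ω = D t ω i - D s ω i := by
          refine ae_all_iff.2 fun i => ?_
          rw [map_sub]
          filter_upwards [Lp.coeFn_sub (wienerMap hW (ψ t i)) (wienerMap hW (ψ s i)),
            hD t i, hD s i] with ω h1 h2 h3
          rw [h1, Pi.sub_apply, ← h2, ← h3]
        filter_upwards [h] with ω hω
        rw [Finset.sum_apply]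
        simp only [hω]
        have h1 := enorm_le_sum_coord (D t ω - D s ω)
        simp only [← ofReal_norm] at h1
        rw [← ENNReal.ofReal_sum_of_nonneg (fun _ _ => norm_nonneg _),
          ENNReal.ofReal_le_ofReal_iff (Finset.sum_nonneg fun _ _ => norm_nonneg _)] at h1
        exact h1.trans (le_abs_self _)
    _ ≤ ∑ i, eLpNorm (fun ω => ‖(wienerMap hW (ψ t i - ψ s i)) ω‖) p P :=
        eLpNorm_sum_le (fun i _ => (Lp.aestronglyMeasurable _).norm)
          (by exact_mod_cast Nat.one_le_iff_ne_zero.2 hp)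
    _ = gaussNorm p * ∑ i, ‖ψ t i - ψ s i‖ₑ := by
        rw [Finset.mul_sum]
        refine Finset.sum_congr rfl fun i _ => ?_
        rw [eLpNorm_norm, eLpNorm_wienerMap, mul_comm]

/-- Termwise integration reduces the expectation to `L^p` norms of increments, each bounded through
its kernel increments by `eLpNorm_sub_le`. -/
theorem lintegral_dyadicSum_le {hW : IsBrownianMotion W P}
    {D : unitInterval → Ω → E n} {ψ : unitInterval → Fin n → Lp (E n) 2 leb}
    (hD : ∀ t i, (fun ω => D t ω i) =ᵐ[P] wienerMap hW (ψ t i)) {p : ℕ} (hp : p ≠ 0) (α : ℝ) :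
    ∫⁻ ω, dyadicSum p α (fun t => D t ω) ∂P ≤ gaussNorm p ^ p * kernelSum p α ψ := by
  have hm := aemeasurable_of_ae_eq_wienerMap hD
  have hsub : ∀ s t, AEMeasurable (fun ω => ‖D t ω - D s ω‖ₑ) P :=
    fun s t => ((hm t).sub (hm s)).enorm
  have hterm : ∀ k i, AEMeasurable (fun ω => (ENNReal.ofReal (2 ^ α) ^ k *
      ‖D (dyadic k (i + 1)) ω - D (dyadic k i) ω‖ₑ) ^ p) P :=
    fun k i => ((hsub _ _).const_mul _).pow_const _
  simp only [dyadicSum, kernelSum]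
  rw [lintegral_tsum fun k => Finset.aemeasurable_fun_sum _ fun i _ => hterm k i,
    ← ENNReal.tsum_mul_left]
  refine ENNReal.tsum_le_tsum fun k => ?_
  rw [lintegral_finsetSum' _ fun i _ => hterm k i, Finset.mul_sum]
  refine Finset.sum_le_sum fun i _ => ?_
  simp only [mul_pow]
  rw [lintegral_const_mul'' _ ((hsub _ _).pow_const _), mul_left_comm]
  gcongr
  rw [← mul_pow]
  have h1 := eLpNorm_sub_le hD hp (dyadic k i) (dyadic k (i + 1))
  refine le_trans (le_of_eq ?_) (pow_le_pow_left' h1 p)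
  have h2 := eLpNorm_nnreal_pow_eq_lintegral (μ := P) (p := (p : ℝ≥0))
    (f := fun ω => D (dyadic k (i + 1)) ω - D (dyadic k i) ω) (by exact_mod_cast hp)
  simpa using h2.symm

end

/-! ### Deterministic estimates for kernel sums -/

section

variable {n : ℕ}

/-- There are `2 ^ k` increments over intervals of length `2 ^ (-k)`, each contributing at most `(2
^ (α k) · n L 2 ^ (-k/2)) ^ p`. -/
theorem kernelSum_term_le {L : ℝ} (hL : 0 ≤ L) {ψ : unitInterval → Fin n → Lp (E n) 2 leb}
    (hψ : ∀ s t c, ‖ψ t c - ψ s c‖ ≤ L * √|(t : ℝ) - s|) (p : ℕ) (α : ℝ) (k : ℕ) :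
    ∑ i ∈ Finset.range (2 ^ k), (ENNReal.ofReal (2 ^ α) ^ k *
      ∑ c, ‖ψ (dyadic k (i + 1)) c - ψ (dyadic k i) c‖ₑ) ^ p ≤
    ENNReal.ofReal ((n * L) ^ p) * ENNReal.ofReal (2 * (2 ^ α * (√2)⁻¹) ^ p) ^ k := by
  have h1 : ∀ i ∈ Finset.range (2 ^ k), (ENNReal.ofReal (2 ^ α) ^ k *
      ∑ c, ‖ψ (dyadic k (i + 1)) c - ψ (dyadic k i) c‖ₑ) ^ p ≤
      ENNReal.ofReal (((2 ^ α) ^ k * (n * (L * (√2)⁻¹ ^ k))) ^ p) := by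
    intro i hi
    rw [ENNReal.ofReal_pow (by positivity), ENNReal.ofReal_mul (by positivity),
      ENNReal.ofReal_pow (by positivity)]
    gcongr
    rw [ENNReal.ofReal_mul (by positivity), ENNReal.ofReal_natCast]
    refine (Finset.sum_le_card_nsmul _ _ (ENNReal.ofReal (L * (√2)⁻¹ ^ k)) fun c _ => ?_).trans ?_
    · rw [← ofReal_norm]
      refine ENNReal.ofReal_le_ofReal ((hψ _ _ c).trans (le_of_eq ?_))
      rw [Finset.mem_range] at hi
      rw [coe_dyadic hi.le, coe_dyadic hi]
      have : (((i + 1 : ℕ) : ℝ) / 2 ^ k - i / 2 ^ k) = (2 ^ k)⁻¹ := by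
        push_cast
        field_simp
        ring
      rw [this, abs_of_pos (by positivity), Real.sqrt_inv, inv_pow]
      congr 2
      rw [Real.sqrt_eq_iff_eq_sq (by positivity) (by positivity), ← pow_mul, mul_comm, pow_mul,
        Real.sq_sqrt (by norm_num)]
    · simp
  refine (Finset.sum_le_card_nsmul _ _ _ h1).trans (le_of_eq ?_)
  rw [Finset.card_range, nsmul_eq_mul, ← ENNReal.ofReal_natCast, ← ENNReal.ofReal_mul
    (by positivity), ← ENNReal.ofReal_pow (by positivity), ← ENNReal.ofReal_mul (by positivity)]
  congr 1
  push_cast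
  simp only [mul_pow, ← pow_mul]
  ring

/-- The geometric ratio is `2 ^ (1 - p (1/2 - α))`, which is below `1` exactly under `hp`. -/
theorem kernelSum_bound_ne_top {p : ℕ} {α : ℝ} (hp : 1 < p * (1 / 2 - α)) (c : ℝ) :
    ∑' k : ℕ, ENNReal.ofReal c * ENNReal.ofReal (2 * (2 ^ α * (√2)⁻¹) ^ p) ^ k ≠ ∞ := by
  rw [ENNReal.tsum_mul_left]
  refine ENNReal.mul_ne_top ENNReal.ofReal_ne_top ?_
  rw [ENNReal.tsum_geometric]
  refine ENNReal.inv_ne_top.2 (tsub_pos_of_lt ?_).ne'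
  rw [ENNReal.ofReal_lt_one]
  have h1 : 2 * ((2 : ℝ) ^ α * (√2)⁻¹) ^ p = 2 ^ (1 - p * (1 / 2 - α)) := by
    rw [Real.sqrt_eq_rpow, ← Real.rpow_neg (by norm_num), ← Real.rpow_add (by norm_num),
      ← Real.rpow_natCast, ← Real.rpow_mul (by norm_num)]
    nth_rewrite 1 [← Real.rpow_one 2]
    rw [← Real.rpow_add (by norm_num)]
    congr 1
    ring
  rw [h1]
  exact Real.rpow_lt_one_of_one_lt_of_neg (by norm_num) (by linarith)

theorem kernelSum_ne_top {L : ℝ} (hL : 0 ≤ L) {ψ : unitInterval → Fin n → Lp (E n) 2 leb}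
    (hψ : ∀ s t c, ‖ψ t c - ψ s c‖ ≤ L * √|(t : ℝ) - s|) {p : ℕ} {α : ℝ}
    (hp : 1 < p * (1 / 2 - α)) : kernelSum p α ψ ≠ ∞ :=
  ne_top_of_le_ne_top (kernelSum_bound_ne_top hp _)
    (ENNReal.tsum_le_tsum fun k => kernelSum_term_le hL hψ p α k)

/-- Dominated convergence over the levels `k` for counting measure: the geometric majorant does not
depend on `j`, so pointwise convergence of the kernels at dyadic times is enough. -/
theorem tendsto_kernelSum {L : ℝ} (hL : 0 ≤ L)
    {ψ : ℕ → unitInterval → Fin n → Lp (E n) 2 leb}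
    (hψ : ∀ j s t c, ‖ψ j t c - ψ j s c‖ ≤ L * √|(t : ℝ) - s|)
    (h0 : ∀ k i c, Tendsto (fun j => ψ j (dyadic k i) c) atTop (𝓝 0)) {p : ℕ} {α : ℝ}
    (hp : 1 < p * (1 / 2 - α)) : Tendsto (fun j => kernelSum p α (ψ j)) atTop (𝓝 0) := by
  have hp0 : p ≠ 0 := by
    rintro rfl
    norm_num at hp
  have key := tendsto_lintegral_filter_of_dominated_convergence (μ := Measure.count (α := ℕ))
    (F := fun j k => ∑ i ∈ Finset.range (2 ^ k), (ENNReal.ofReal (2 ^ α) ^ k *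
      ∑ c, ‖ψ j (dyadic k (i + 1)) c - ψ j (dyadic k i) c‖ₑ) ^ p) (f := fun _ => 0)
    (l := atTop)
    (fun k => ENNReal.ofReal ((n * L) ^ p) * ENNReal.ofReal (2 * (2 ^ α * (√2)⁻¹) ^ p) ^ k)
    (Eventually.of_forall fun j => measurable_of_countable _)
    (Eventually.of_forall fun j => Eventually.of_forall fun k =>
      kernelSum_term_le hL (hψ j) p α k)
    (by rw [lintegral_count]; exact kernelSum_bound_ne_top hp _)
    (Eventually.of_forall fun k => by
      have h1 : ∀ i c, Tendsto (fun j => ‖ψ j (dyadic k (i + 1)) c - ψ j (dyadic k i) c‖ₑ)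
          atTop (𝓝 0) := fun i c => by
        simpa using ((h0 k (i + 1) c).sub (h0 k i c)).enorm
      have h2 : ∀ i, Tendsto (fun j => (ENNReal.ofReal (2 ^ α) ^ k *
          ∑ c, ‖ψ j (dyadic k (i + 1)) c - ψ j (dyadic k i) c‖ₑ) ^ p) atTop (𝓝 0) := fun i => by
        have h3 := tendsto_finsetSum Finset.univ fun c _ => h1 i c
        rw [Finset.sum_const_zero] at h3
        have h4 := ENNReal.Tendsto.const_mul h3
          (Or.inr (ENNReal.pow_ne_top ENNReal.ofReal_ne_top : ENNReal.ofReal (2 ^ α) ^ k ≠ ∞))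
        rw [mul_zero] at h4
        have h5 := ENNReal.Tendsto.pow (n := p) h4
        rwa [zero_pow hp0] at h5
      have h3 := tendsto_finsetSum (Finset.range (2 ^ k)) fun i _ => h2 i
      rwa [Finset.sum_const_zero] at h3)
  simpa only [lintegral_count, tsum_zero, kernelSum] using key

end

/-! ### The isometry `h ↦ h'` from `H¹` onto `L²` -/

section

variable {n : ℕ}

theorem intervalIntegrable_of_mem {f : ℝ → E n} (hf : Integrable f leb) {a b : ℝ}
    (ha : a ∈ Icc (0 : ℝ) 1) (hb : b ∈ Icc (0 : ℝ) 1) : IntervalIntegrable f volume a b := by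
  have h : IntervalIntegrable f volume 0 1 := by
    rw [intervalIntegrable_iff_integrableOn_Icc_of_le zero_le_one]
    exact hf
  refine h.mono_set ?_
  rw [uIcc_of_le zero_le_one]
  exact uIcc_subset_Icc ha hb

theorem absolutelyContinuousOnInterval_congr {X : Type*} [PseudoMetricSpace X] {f g : ℝ → X}
    {a b : ℝ} (hf : AbsolutelyContinuousOnInterval f a b) (hfg : EqOn f g (uIcc a b)) :
    AbsolutelyContinuousOnInterval g a b := by
  rw [absolutelyContinuousOnInterval_iff] at hf ⊢
  intro ε hε
  obtain ⟨δ, hδ, h⟩ := hf ε hε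
  refine ⟨δ, hδ, fun I hI hI' => ?_⟩
  refine lt_of_eq_of_lt (Finset.sum_congr rfl fun i hi => ?_) (h I hI hI')
  rw [hfg (hI.1 i hi).1, hfg (hI.1 i hi).2]

theorem absolutelyContinuousOnInterval_sum {ι F : Type*} [NormedAddCommGroup F] (s : Finset ι)
    {f : ι → ℝ → F} {a b : ℝ} (hf : ∀ i ∈ s, AbsolutelyContinuousOnInterval (f i) a b) :
    AbsolutelyContinuousOnInterval (∑ i ∈ s, f i) a b := by
  classical
  induction s using Finset.induction_on with
  | empty =>
    rw [Finset.sum_empty]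
    exact (LipschitzWith.const (0 : F)).lipschitzOnWith.absolutelyContinuousOnInterval
  | insert i s hi ih =>
    rw [Finset.sum_insert hi]
    exact (hf i (Finset.mem_insert_self _ _)).add
      (ih fun j hj => hf j (Finset.mem_insert_of_mem hj))

theorem absolutelyContinuousOnInterval_integral {f : ℝ → E n} (hf : Integrable f leb) :
    AbsolutelyContinuousOnInterval (fun x => ∫ s in (0 : ℝ)..x, f s) 0 1 := by
  have h0 : (0 : ℝ) ∈ Icc (0 : ℝ) 1 := left_mem_Icc.2 zero_le_one
  have h1 : ∀ i, AbsolutelyContinuousOnInterval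
      (fun x => (∫ s in (0 : ℝ)..x, f s i) • (EuclideanSpace.single i 1 : E n)) 0 1 := by
    intro i
    have hi : IntervalIntegrable (fun s => f s i) volume 0 1 := by
      rw [intervalIntegrable_iff_integrableOn_Icc_of_le zero_le_one]
      exact hf.eval_piLp i
    exact (hi.absolutelyContinuousOnInterval_intervalIntegral left_mem_uIcc).smul
      ((LipschitzWith.const (EuclideanSpace.single i (1 : ℝ) : E n)).lipschitzOnWith
        |>.absolutelyContinuousOnInterval)
  refine absolutelyContinuousOnInterval_congr
    (absolutelyContinuousOnInterval_sum Finset.univ fun i _ => h1 i) fun x hx => ?_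
  rw [uIcc_of_le zero_le_one] at hx
  ext j
  have h2 := (EuclideanSpace.proj (𝕜 := ℝ) j : E n →L[ℝ] ℝ).intervalIntegral_comp_comm
    (intervalIntegrable_of_mem hf h0 hx)
  simp only [PiLp.proj_apply] at h2
  simp [Finset.sum_apply, Pi.single_apply, ← h2]

/-- The isometry `h ↦ h'` from `H¹` to `L²`. -/
noncomputable def derLp (n : ℕ) : H1 n →ₗᵢ[ℝ] Lp (E n) 2 leb where
  toFun h := h.memLp_der.toLp h.der
  map_add' h k := by
    rw [← MemLp.toLp_add]
    exact (MemLp.toLp_eq_toLp_iff _ _).2 (H1.der_add h k)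
  map_smul' c h := by
    rw [RingHom.id_apply, ← MemLp.toLp_const_smul]
    exact (MemLp.toLp_eq_toLp_iff _ _).2 (H1.der_smul c h)
  norm_map' h := by
    have h1 : ‖h.memLp_der.toLp h.der‖ ^ 2 = ‖h‖ ^ 2 := by
      rw [← real_inner_self_eq_norm_sq, ← real_inner_self_eq_norm_sq, H1.inner_def, L2.inner_def]
      refine integral_congr_ae ?_
      filter_upwards [h.memLp_der.coeFn_toLp] with s hs
      rw [hs]
    exact (sq_eq_sq₀ (norm_nonneg _) (norm_nonneg _)).1 h1

theorem coeFn_derLp (h : H1 n) : derLp n h =ᵐ[leb] h.der := h.memLp_der.coeFn_toLp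

/-- A preimage of `f` is its primitive, by Lebesgue differentiation. Surjectivity lets statements
about projections of `H¹` be applied to the kernels, which live in `L²`. -/
theorem derLp_surjective (n : ℕ) : Function.Surjective (derLp n) := by
  intro f
  have hint : Integrable f leb := (Lp.memLp f).integrable one_le_two
  set k : unitInterval → E n := fun t => ∫ s in (0 : ℝ)..t, f s with hk
  have hext : ∀ x ∈ Icc (0 : ℝ) 1, IccExtend (zero_le_one' ℝ) k x = ∫ s in (0 : ℝ)..x, f s :=
    fun x hx => IccExtend_of_mem _ _ hx
  have hae : pathDeriv k =ᵐ[leb] f := by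
    have hii : IntervalIntegrable f volume 0 1 := by
      rw [intervalIntegrable_iff_integrableOn_Icc_of_le zero_le_one]
      exact hint
    refine (ae_restrict_iff' measurableSet_Icc).2 ?_
    -- The endpoints are discarded: the extension by constants is known to agree with the primitive
    -- only on `[0, 1]`.
    filter_upwards [hii.ae_hasDerivAt_integral, Measure.ae_ne volume (0 : ℝ),
      Measure.ae_ne volume (1 : ℝ)] with x hx hx0 hx1 hmem
    rw [uIcc_of_le zero_le_one] at hx
    have h5 := hx hmem 0 (left_mem_Icc.2 zero_le_one)
    refine (h5.congr_of_eventuallyEq ?_).deriv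
    filter_upwards [Icc_mem_nhds (lt_of_le_of_ne hmem.1 hx0.symm)
      (lt_of_le_of_ne hmem.2 hx1)] with y hy using hext y hy
  have hcm : IsCameronMartin k := by
    refine ⟨by simp [hk], ?_, (memLp_congr_ae hae).2 (Lp.memLp f)⟩
    refine absolutelyContinuousOnInterval_congr (absolutelyContinuousOnInterval_integral hint)
      fun x hx => ?_
    rw [uIcc_of_le zero_le_one] at hx
    exact (hext x hx).symm
  refine ⟨⟨k, hcm⟩, ?_⟩
  rw [Lp.ext_iff]
  exact (coeFn_derLp _).trans hae

end

/-! ### The kernels of the process `∫ g dW` -/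

section

variable {n : ℕ} {g : ℝ → Matrix (Fin n) (Fin n) ℝ}

/-- The function `1_{[0, t]}` times the `i`-th row of `g`. -/
noncomputable def rowFun (g : ℝ → Matrix (Fin n) (Fin n) ℝ) (t : unitInterval) (i : Fin n) :
    ℝ → E n :=
  (Icc (0 : ℝ) t).indicator fun s => (WithLp.toLp 2 (g s i) : E n)

theorem continuousOn_row (hg : ∀ i j, ContinuousOn (fun t => g t i j) (Icc 0 1)) (i : Fin n) :
    ContinuousOn (fun s => (WithLp.toLp 2 (g s i) : E n)) (Icc 0 1) :=
  (PiLp.continuous_toLp 2 _).comp_continuousOn (continuousOn_pi.2 fun j => hg i j)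

theorem exists_row_bound (hg : ∀ i j, ContinuousOn (fun t => g t i j) (Icc 0 1)) :
    ∃ L : ℝ, 0 ≤ L ∧ ∀ i, ∀ s ∈ Icc (0 : ℝ) 1, ‖(WithLp.toLp 2 (g s i) : E n)‖ ≤ L := by
  choose C hC using fun i => isCompact_Icc.exists_bound_of_continuousOn (continuousOn_row hg i)
  refine ⟨∑ i, |C i|, by positivity, fun i s hs => (hC i s hs).trans ((le_abs_self _).trans ?_)⟩
  exact Finset.single_le_sum (f := fun i => |C i|) (fun _ _ => abs_nonneg _) (Finset.mem_univ i)

theorem memLp_row (hg : ∀ i j, ContinuousOn (fun t => g t i j) (Icc 0 1)) (i : Fin n) :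
    MemLp (fun s => (WithLp.toLp 2 (g s i) : E n)) 2 leb := by
  obtain ⟨L, -, hL⟩ := exists_row_bound hg
  refine MemLp.of_bound ((continuousOn_row hg i).aestronglyMeasurable measurableSet_Icc) L ?_
  exact (ae_restrict_iff' measurableSet_Icc).2 (Eventually.of_forall fun s hs => hL i s hs)

theorem memLp_rowFun (hg : ∀ i j, ContinuousOn (fun t => g t i j) (Icc 0 1)) (t : unitInterval)
    (i : Fin n) : MemLp (rowFun g t i) 2 leb :=
  (memLp_row hg i).indicator measurableSet_Icc

/-- The class in `L²` of `1_{[0, t]}` times the `i`-th row of `g`. -/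
noncomputable def rowStep (hg : ∀ i j, ContinuousOn (fun t => g t i j) (Icc 0 1))
    (t : unitInterval) (i : Fin n) : Lp (E n) 2 leb :=
  (memLp_rowFun hg t i).toLp

theorem rowStep_zero (hg : ∀ i j, ContinuousOn (fun t => g t i j) (Icc 0 1)) (i : Fin n) :
    rowStep hg 0 i = 0 := by
  rw [Lp.eq_zero_iff_ae_eq_zero]
  refine (memLp_rowFun hg 0 i).coeFn_toLp.trans ?_
  filter_upwards [ae_restrict_of_ae (Measure.ae_ne volume (0 : ℝ))] with s hs
  rw [rowFun, indicator_of_notMem]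
  · rfl
  · simpa using hs

/-- For `s ≤ t` the difference is the bounded row restricted to `(s, t]`, a set of measure `t - s`.
This is the source of the threshold `α < 1/2`. -/
theorem exists_norm_rowStep_sub_le (hg : ∀ i j, ContinuousOn (fun t => g t i j) (Icc 0 1)) :
    ∃ L : ℝ, 0 ≤ L ∧ ∀ s t i, ‖rowStep hg t i - rowStep hg s i‖ ≤ L * √|(t : ℝ) - s| := by
  obtain ⟨L, hL0, hL⟩ := exists_row_bound hg
  refine ⟨L, hL0, ?_⟩
  have key : ∀ s t : unitInterval, s ≤ t → ∀ i,
      ‖rowStep hg t i - rowStep hg s i‖ ≤ L * √|(t : ℝ) - s| := by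
    intro s t hst i
    have hst' : (s : ℝ) ≤ t := hst
    have h1 : rowFun g t i - rowFun g s i =
        (Ioc (s : ℝ) t).indicator fun u => (WithLp.toLp 2 (g u i) : E n) := by
      have h2 : Ioc (s : ℝ) t = Icc (0 : ℝ) t \ Icc (0 : ℝ) s := by
        ext u
        simp only [mem_Ioc, Set.mem_sdiff, mem_Icc]
        constructor
        · exact fun h => ⟨⟨s.2.1.trans h.1.le, h.2⟩, fun h' => absurd h'.2 (not_le.2 h.1)⟩
        · exact fun h => ⟨not_le.1 fun h' => h.2 ⟨h.1.1, h'⟩, h.1.2⟩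
      rw [h2, indicator_sdiff (Icc_subset_Icc_right hst')]
      rfl
    rw [rowStep, rowStep, ← MemLp.toLp_sub, Lp.norm_toLp, h1,
      eLpNorm_indicator_eq_eLpNorm_restrict measurableSet_Ioc]
    refine ENNReal.toReal_le_of_le_ofReal (by positivity) ?_
    refine (eLpNorm_le_of_ae_bound (C := L) ?_).trans ?_
    · rw [Measure.restrict_restrict measurableSet_Ioc]
      refine (ae_restrict_iff' (measurableSet_Ioc.inter measurableSet_Icc)).2
        (Eventually.of_forall fun u hu => hL i u hu.2)
    · rw [mul_comm L, ENNReal.ofReal_mul (by positivity), Measure.restrict_apply_univ]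
      gcongr
      rw [Measure.restrict_apply measurableSet_Ioc, Real.sqrt_eq_rpow,
        ← ENNReal.ofReal_rpow_of_nonneg (abs_nonneg _) (by norm_num)]
      have : ((2 : ℝ≥0∞).toReal)⁻¹ = (1 / 2 : ℝ) := by norm_num
      rw [this]
      refine ENNReal.rpow_le_rpow ((measure_mono inter_subset_left).trans ?_) (by norm_num)
      rw [Real.volume_Ioc, abs_of_nonneg (by linarith)]
  intro s t i
  rcases le_total s t with h | h
  · exact key s t h i
  · rw [norm_sub_rev, abs_sub_comm]
    exact key t s h i

theorem inner_rowStep (hg : ∀ i j, ContinuousOn (fun t => g t i j) (Icc 0 1)) (t : unitInterval)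
    (i : Fin n) (v : Lp (E n) 2 leb) :
    ⟪rowStep hg t i, v⟫_ℝ = ∫ s in (0 : ℝ)..t, ⟪(WithLp.toLp 2 (g s i) : E n), v s⟫_ℝ := by
  have h1 : Icc (0 : ℝ) t ∩ Icc (0 : ℝ) 1 = Icc (0 : ℝ) t :=
    inter_eq_left.2 (Icc_subset_Icc_right t.2.2)
  have h2 : ∫ s in Icc (0 : ℝ) t, ⟪(WithLp.toLp 2 (g s i) : E n), v s⟫_ℝ =
      ∫ s, (Icc (0 : ℝ) t).indicator (fun s => ⟪(WithLp.toLp 2 (g s i) : E n), v s⟫_ℝ) s ∂leb := by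
    rw [integral_indicator measurableSet_Icc, Measure.restrict_restrict measurableSet_Icc, h1]
  rw [L2.inner_def, intervalIntegral.integral_of_le t.2.1, ← integral_Icc_eq_integral_Ioc, h2]
  refine integral_congr_ae ?_
  filter_upwards [(memLp_rowFun hg t i).coeFn_toLp] with s hs
  rw [rowStep, hs, rowFun]
  by_cases h : s ∈ Icc (0 : ℝ) t
  · rw [indicator_of_mem h, indicator_of_mem h]
  · rw [indicator_of_notMem h, indicator_of_notMem h, inner_zero_left]

/-- The path `t ↦ ∫₀ᵗ g(s) v(s) ds`. -/
noncomputable def pairing (hg : ∀ i j, ContinuousOn (fun t => g t i j) (Icc 0 1)) :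
    Lp (E n) 2 leb →ₗ[ℝ] (unitInterval → E n) where
  toFun v t := WithLp.toLp 2 fun i => ⟪rowStep hg t i, v⟫_ℝ
  map_add' v w := by
    ext t i
    simp [inner_add_right]
  map_smul' c v := by
    ext t i
    simp [inner_smul_right]

theorem pairing_apply (hg : ∀ i j, ContinuousOn (fun t => g t i j) (Icc 0 1))
    (v : Lp (E n) 2 leb) (t : unitInterval) (i : Fin n) :
    pairing hg v t i = ⟪rowStep hg t i, v⟫_ℝ := rfl

theorem pairing_zero_left (hg : ∀ i j, ContinuousOn (fun t => g t i j) (Icc 0 1))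
    (v : Lp (E n) 2 leb) : pairing hg v 0 = 0 := by
  ext i
  rw [pairing_apply, rowStep_zero, inner_zero_left]
  rfl

/-- Cauchy–Schwarz in each coordinate; the path is `1/2`-Hölder, hence has a finite `α`-Hölder norm
for `0 < α < 1/2`. -/
theorem exists_norm_pairing_sub_le (hg : ∀ i j, ContinuousOn (fun t => g t i j) (Icc 0 1))
    (v : Lp (E n) 2 leb) :
    ∃ C : ℝ, 0 ≤ C ∧ ∀ s t, ‖pairing hg v s - pairing hg v t‖ ≤ C * √|(s : ℝ) - t| := by
  obtain ⟨L, hL0, hL⟩ := exists_norm_rowStep_sub_le hg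
  refine ⟨n * (L * ‖v‖), by positivity, fun s t => ?_⟩
  have h1 := enorm_le_sum_coord (pairing hg v s - pairing hg v t)
  simp only [← ofReal_norm] at h1
  rw [← ENNReal.ofReal_sum_of_nonneg (fun _ _ => norm_nonneg _),
    ENNReal.ofReal_le_ofReal_iff (Finset.sum_nonneg fun _ _ => norm_nonneg _)] at h1
  refine h1.trans ((Finset.sum_le_card_nsmul _ _ (L * ‖v‖ * √|(s : ℝ) - t|) fun i _ => ?_).trans ?_)
  · rw [PiLp.sub_apply, pairing_apply, pairing_apply, ← inner_sub_left]
    refine (norm_inner_le_norm _ _).trans ?_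
    calc _ ≤ L * √|(s : ℝ) - t| * ‖v‖ := by gcongr; exact hL t s i
      _ = _ := by ring
  · simp [mul_assoc]

theorem continuous_pairing (hg : ∀ i j, ContinuousOn (fun t => g t i j) (Icc 0 1))
    (v : Lp (E n) 2 leb) : Continuous (pairing hg v) := by
  obtain ⟨C, -, hC⟩ := exists_norm_pairing_sub_le hg v
  rw [continuous_iff_continuousAt]
  intro t
  rw [ContinuousAt, tendsto_iff_norm_sub_tendsto_zero]
  refine squeeze_zero (fun _ => norm_nonneg _) (fun s => hC s t) ?_
  have h : Continuous fun s : unitInterval => C * √|(s : ℝ) - t| := by fun_prop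
  have h1 := h.tendsto t
  simpa using h1

theorem holderNorm_pairing_ne_top (hg : ∀ i j, ContinuousOn (fun t => g t i j) (Icc 0 1))
    (v : Lp (E n) 2 leb) {α : ℝ} (hα0 : 0 < α) (hα : α < 1 / 2) :
    holderNorm α (pairing hg v) ≠ ∞ := by
  obtain ⟨C, hC0, hC⟩ := exists_norm_pairing_sub_le hg v
  refine ne_top_of_le_ne_top ?_ (holderNorm_le (c := C) (pairing_zero_left hg v) hα0
    fun s t => (hC s t).trans ?_)
  · exact ENNReal.mul_ne_top (by norm_num) ENNReal.ofReal_ne_top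
  · gcongr
    rw [Real.sqrt_eq_rpow]
    have hle : |(s : ℝ) - t| ≤ 1 := by
      rw [abs_le]
      constructor <;> linarith [s.2.1, s.2.2, t.2.1, t.2.2]
    exact Real.rpow_le_rpow_of_exponent_ge_of_imp (abs_nonneg _) hle hα.le (by grind)

theorem integrable_mulVec (hg : ∀ i j, ContinuousOn (fun t => g t i j) (Icc 0 1)) {f : ℝ → E n}
    (hf : MemLp f 2 leb) :
    Integrable (fun s => (WithLp.toLp 2 ((g s).mulVec (WithLp.ofLp (f s))) : E n)) leb := by
  refine Integrable.of_eval_piLp fun i => ?_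
  refine (integrable_inner_of_memLp hf (memLp_row hg i)).congr (Eventually.of_forall fun s => ?_)
  simp only [PiLp.inner_apply, Matrix.mulVec, dotProduct]
  rfl

theorem Ng_eq (hg : ∀ i j, ContinuousOn (fun t => g t i j) (Icc 0 1)) (α : ℝ) (h : H1 n) :
    Ng g α h = holderNorm α (pairing hg (derLp n h)) := by
  rw [Ng]
  congr 1
  funext t
  ext i
  rw [pairing_apply, inner_rowStep]
  have h0 : (0 : ℝ) ∈ Icc (0 : ℝ) 1 := left_mem_Icc.2 zero_le_one
  have h2 := (EuclideanSpace.proj (𝕜 := ℝ) i : E n →L[ℝ] ℝ).intervalIntegral_comp_comm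
    (intervalIntegrable_of_mem (integrable_mulVec hg h.memLp_der) h0 t.2)
  simp only [PiLp.proj_apply] at h2
  rw [← h2, intervalIntegral.integral_of_le t.2.1, intervalIntegral.integral_of_le t.2.1]
  refine integral_congr_ae ?_
  have h3 := ae_restrict_of_ae_restrict_of_subset
    ((Ioc_subset_Icc_self.trans (Icc_subset_Icc_right t.2.2) : Ioc (0 : ℝ) t ⊆ Icc 0 1))
    (coeFn_derLp h)
  filter_upwards [h3] with s hs
  rw [hs]
  simp [PiLp.inner_apply, Matrix.mulVec, dotProduct, mul_comm]

theorem isSeminorm_Ng (hg : ∀ i j, ContinuousOn (fun t => g t i j) (Icc 0 1)) {α : ℝ}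
    (hα0 : 0 < α) (hα : α < 1 / 2) : IsSeminorm (Ng g α) where
  lt_top h := by
    rw [Ng_eq hg]
    exact (holderNorm_pairing_ne_top hg _ hα0 hα).lt_top
  add_le h k := by
    simp only [Ng_eq hg, map_add]
    exact holderNorm_add_le _ _ _
  smul c h := by
    simp only [Ng_eq hg, map_smul]
    exact holderNorm_smul _ _ _

theorem ae_eq_zero_of_integral_eq_zero {f : ℝ → E n} (hf : Integrable f leb)
    (h : ∀ t : unitInterval, ∫ s in (0 : ℝ)..t, f s = 0) : f =ᵐ[leb] 0 := by
  have hii : IntervalIntegrable f volume 0 1 := by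
    rw [intervalIntegrable_iff_integrableOn_Icc_of_le zero_le_one]
    exact hf
  refine (ae_restrict_iff' measurableSet_Icc).2 ?_
  filter_upwards [hii.ae_hasDerivAt_integral, Measure.ae_ne volume (0 : ℝ),
    Measure.ae_ne volume (1 : ℝ)] with x hx hx0 hx1 hmem
  rw [uIcc_of_le zero_le_one] at hx
  have h5 := hx hmem 0 (left_mem_Icc.2 zero_le_one)
  have h6 : (fun x => ∫ s in (0 : ℝ)..x, f s) =ᶠ[𝓝 x] fun _ => 0 := by
    filter_upwards [Icc_mem_nhds (lt_of_le_of_ne hmem.1 hx0.symm)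
      (lt_of_le_of_ne hmem.2 hx1)] with y hy using h ⟨y, hy⟩
  exact (h5.congr_of_eventuallyEq h6.symm).unique (hasDerivAt_const x 0)

theorem eq_zero_of_Ng_eq_zero (hg : ∀ i j, ContinuousOn (fun t => g t i j) (Icc 0 1))
    (hdet : ∀ t ∈ Icc (0 : ℝ) 1, (g t).det ≠ 0) {α : ℝ} {h : H1 n} (h0 : Ng g α h = 0) :
    h = 0 := by
  refine H1.eq_zero_of_der h ?_
  rw [Ng, holderNorm, add_eq_zero] at h0
  have h1 := ae_eq_zero_of_integral_eq_zero (integrable_mulVec hg h.memLp_der) fun t =>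
    enorm_eq_zero.1 (ENNReal.iSup_eq_zero.1 h0.1 t)
  filter_upwards [h1, ae_restrict_mem measurableSet_Icc] with s hs hmem
  have h2 : (g s).mulVec (WithLp.ofLp (h.der s)) = 0 := by
    simpa using congrArg WithLp.ofLp hs
  have h3 := Matrix.eq_zero_of_mulVec_eq_zero (hdet s hmem) h2
  exact (WithLp.ofLp_injective 2) h3

end

/-! ### Finite-dimensional approximations of the process `∫ g dW` -/

section

variable {F : Type*} [NormedAddCommGroup F] [InnerProductSpace ℝ F] {d : ℕ}

/-- The difference of the projection onto the span of the family `b` and the identity. -/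
noncomputable def residual (b : Fin d → F) (f : F) : F := ∑ j, ⟪b j, f⟫_ℝ • b j - f

theorem residual_sub (b : Fin d → F) (f k : F) :
    residual b f - residual b k = residual b (f - k) := by
  simp only [residual, inner_sub_right, sub_smul, Finset.sum_sub_distrib]
  abel

theorem residual_eq_starProjection_sub {V : Submodule ℝ F} [FiniteDimensional ℝ V]
    (b : OrthonormalBasis (Fin d) ℝ V) (f : F) :
    residual (fun j => (b j : F)) f = V.starProjection f - f := by
  rw [residual, b.starProjection_eq_sum_rankOne]
  simp

/-- Up to sign the residual is the projection onto the orthogonal complement. The bound is uniform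
in `V`, so residual kernels inherit the increment bound of the original ones. -/
theorem norm_residual_le {V : Submodule ℝ F} [FiniteDimensional ℝ V]
    (b : OrthonormalBasis (Fin d) ℝ V) (f : F) :
    ‖residual (fun j => (b j : F)) f‖ ≤ ‖f‖ := by
  rw [residual_eq_starProjection_sub, norm_sub_rev]
  have h := Vᗮ.norm_starProjection_apply_le f
  rwa [Submodule.starProjection_orthogonal_val] at h

theorem inner_residual_eq_zero {b : Fin d → F} (hb : Orthonormal ℝ b) (j : Fin d) (f : F) :
    ⟪b j, residual b f⟫_ℝ = 0 := by
  rw [residual, inner_sub_right, hb.inner_right_fintype, sub_self]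

theorem residual_map {G : Type*} [NormedAddCommGroup G] [InnerProductSpace ℝ G] (T : F →ₗᵢ[ℝ] G)
    (b : Fin d → F) (f : F) : residual (fun j => T (b j)) (T f) = T (residual b f) := by
  simp [residual]

end

/-! ### The error process, convergence in probability and the continuous version -/

section

variable {Ω : Type*} [MeasurableSpace Ω] {n : ℕ} {W : unitInterval → Ω → E n} {P : Measure Ω}
  {g : ℝ → Matrix (Fin n) (Fin n) ℝ} {A : unitInterval → Ω → E n} {d : ℕ}

/-- The random variable `∑ⱼ (∫₀¹ ⟨bⱼ, dW⟩) bⱼ` with values in `L²`. -/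
noncomputable def whiteNoise (hW : IsBrownianMotion W P) (b : Fin d → Lp (E n) 2 leb) (ω : Ω) :
    Lp (E n) 2 leb :=
  ∑ j, wienerMap hW (b j) ω • b j

theorem derLp_projW (hW : IsBrownianMotion W P) (b : Fin d → H1 n) (ω : Ω) :
    derLp n (projW hW b ω) = whiteNoise hW (fun j => derLp n (b j)) ω := by
  rw [projW, whiteNoise, map_sum]
  refine Finset.sum_congr rfl fun j _ => ?_
  rw [map_smul, wienerIntegral, dif_pos (b j).memLp_der]
  rfl

theorem wienerIntegral_row (hW : IsBrownianMotion W P)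
    (hg : ∀ i j, ContinuousOn (fun t => g t i j) (Icc 0 1)) (t : unitInterval) (i : Fin n) :
    wienerIntegral hW ((Icc (0 : ℝ) t).indicator fun s => (WithLp.toLp 2 (g s i) : E n)) =
      wienerMap hW (rowStep hg t i) :=
  dif_pos (memLp_rowFun hg t i)

theorem IsWienerIntegralProcess.ae_eq_wienerMap {hW : IsBrownianMotion W P}
    (hA : IsWienerIntegralProcess hW g A)
    (hg : ∀ i j, ContinuousOn (fun t => g t i j) (Icc 0 1)) (t : unitInterval) (i : Fin n) :
    (fun ω => A t ω i) =ᵐ[P] wienerMap hW (rowStep hg t i) := by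
  rw [← wienerIntegral_row hW hg]
  exact hA.eq_integral t i

/-- Linearity of the Wiener integral: `⟨k, ∑ⱼ I(bⱼ) bⱼ⟩ = I(∑ⱼ ⟨bⱼ, k⟩ bⱼ)`. The error of the
approximation thus becomes a Gaussian process with explicit kernels. -/
theorem pairing_whiteNoise_sub_ae_eq {hW : IsBrownianMotion W P}
    (hA : IsWienerIntegralProcess hW g A)
    (hg : ∀ i j, ContinuousOn (fun t => g t i j) (Icc 0 1)) (b : Fin d → Lp (E n) 2 leb)
    (t : unitInterval) (i : Fin n) :
    (fun ω => (pairing hg (whiteNoise hW b ω) t - A t ω) i) =ᵐ[P]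
      wienerMap hW (residual b (rowStep hg t i)) := by
  rw [residual, map_sub, map_sum]
  have h1 : ∀ᵐ ω ∂P, ∀ j, wienerMap hW (⟪b j, rowStep hg t i⟫_ℝ • b j) ω =
      ⟪b j, rowStep hg t i⟫_ℝ * wienerMap hW (b j) ω := by
    refine ae_all_iff.2 fun j => ?_
    rw [map_smul]
    filter_upwards [Lp.coeFn_smul ⟪b j, rowStep hg t i⟫_ℝ (wienerMap hW (b j))] with ω hω
    rw [hω]
    rfl
  filter_upwards [h1, hA.ae_eq_wienerMap hg t i,
    Lp.coeFn_sub (∑ j, wienerMap hW (⟪b j, rowStep hg t i⟫_ℝ • b j))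
      (wienerMap hW (rowStep hg t i)),
    Lp.coeFn_finsetSum Finset.univ fun j => wienerMap hW (⟪b j, rowStep hg t i⟫_ℝ • b j)]
    with ω h2 h3 h4 h5
  rw [h4, Pi.sub_apply, h5, Finset.sum_apply, ← h3, PiLp.sub_apply, pairing_apply, whiteNoise,
    inner_sum]
  congr 1
  refine Finset.sum_congr rfl fun j _ => ?_
  rw [h2, inner_smul_right, real_inner_comm, mul_comm]

theorem IsWienerIntegralProcess.aemeasurable {hW : IsBrownianMotion W P}
    (hA : IsWienerIntegralProcess hW g A)
    (hg : ∀ i j, ContinuousOn (fun t => g t i j) (Icc 0 1)) (t : unitInterval) :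
    AEMeasurable (A t) P :=
  aemeasurable_of_ae_eq_wienerMap (hA.ae_eq_wienerMap hg) t

theorem IsWienerIntegralProcess.ae_zero {hW : IsBrownianMotion W P}
    (hA : IsWienerIntegralProcess hW g A)
    (hg : ∀ i j, ContinuousOn (fun t => g t i j) (Icc 0 1)) : ∀ᵐ ω ∂P, A 0 ω = 0 := by
  have h : ∀ᵐ ω ∂P, ∀ i, A 0 ω i = 0 := by
    refine ae_all_iff.2 fun i => ?_
    have h1 := hA.ae_eq_wienerMap hg 0 i
    rw [rowStep_zero, map_zero] at h1
    filter_upwards [h1, Lp.coeFn_zero ℝ 2 P] with ω h2 h3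
    rw [h2, h3]
    rfl
  filter_upwards [h] with ω hω
  ext i
  exact hω i

theorem IsWienerIntegralProcess.aemeasurable_holderNorm {hW : IsBrownianMotion W P}
    (hA : IsWienerIntegralProcess hW g A)
    (hg : ∀ i j, ContinuousOn (fun t => g t i j) (Icc 0 1)) (α : ℝ) :
    AEMeasurable (fun ω => holderNorm α fun t => A t ω) P := by
  obtain ⟨u, v, huv⟩ := exists_holderNorm_eq_iSup_seq n α
  have hm := hA.aemeasurable hg
  have h1 : AEMeasurable (fun ω => (⨆ j, ‖A (u j) ω‖ₑ) +
      ⨆ j, ‖A (v j).1 ω - A (v j).2 ω‖ₑ / edist (v j).1 (v j).2 ^ α) P :=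
    (AEMeasurable.iSup fun j => (hm _).enorm).add
      (AEMeasurable.iSup fun j => ((hm _).sub (hm _)).enorm.div_const _)
  refine h1.congr ?_
  filter_upwards [hA.continuous_paths] with ω hω
  rw [huv _ hω]

theorem holderNorm_pairing_whiteNoise_le (hW : IsBrownianMotion W P)
    (hg : ∀ i j, ContinuousOn (fun t => g t i j) (Icc 0 1)) (b : Fin d → Lp (E n) 2 leb) {α δ : ℝ}
    {ω : Ω} (hω : ∀ j, |wienerMap hW (b j) ω| ≤ δ) :
    holderNorm α (pairing hg (whiteNoise hW b ω)) ≤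
      ENNReal.ofReal δ * ∑ j, holderNorm α (pairing hg (b j)) := by
  have h0 : holderNorm α (0 : unitInterval → E n) = 0 := by
    have := holderNorm_smul α 0 (0 : unitInterval → E n)
    simpa using this
  rw [whiteNoise, map_sum, Finset.mul_sum]
  refine (Finset.le_sum_of_subadditive (holderNorm α) h0.le (holderNorm_add_le α) _ _).trans
    (Finset.sum_le_sum fun j _ => ?_)
  rw [map_smul, holderNorm_smul]
  gcongr
  rw [← ofReal_norm, Real.norm_eq_abs]
  exact ENNReal.ofReal_le_ofReal (hω j)

variable [IsProbabilityMeasure P]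

theorem ae_dyadicSum_ne_top {hW : IsBrownianMotion W P}
    (hg : ∀ i j, ContinuousOn (fun t => g t i j) (Icc 0 1))
    (hA : ∀ t i, (fun ω => A t ω i) =ᵐ[P] wienerMap hW (rowStep hg t i))
    {p : ℕ} {α : ℝ} (hp : 1 < p * (1 / 2 - α)) :
    ∀ᵐ ω ∂P, dyadicSum p α (fun t => A t ω) ≠ ∞ := by
  have hp0 : p ≠ 0 := by
    rintro rfl
    norm_num at hp
  obtain ⟨L, hL0, hL⟩ := exists_norm_rowStep_sub_le hg
  have h1 := lintegral_dyadicSum_le hA hp0 α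
  have h2 : ∫⁻ ω, dyadicSum p α (fun t => A t ω) ∂P ≠ ∞ :=
    ne_top_of_le_ne_top (ENNReal.mul_ne_top (ENNReal.pow_ne_top (gaussNorm_ne_top p))
      (kernelSum_ne_top hL0 hL hp)) h1
  filter_upwards [ae_lt_top' (aemeasurable_dyadicSum (aemeasurable_of_ae_eq_wienerMap hA) p α) h2]
    with ω hω using hω.ne

/-- Choose representatives `B t` freely and take limits along dyadic floors. The limit is a version
because the kernels depend continuously on `t` in `L²` and limits in probability are unique. -/
theorem exists_isWienerIntegralProcess (hW : IsBrownianMotion W P)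
    (hg : ∀ i j, ContinuousOn (fun t => g t i j) (Icc 0 1)) :
    ∃ A : unitInterval → Ω → E n, IsWienerIntegralProcess hW g A := by
  set B : unitInterval → Ω → E n :=
    fun t ω => WithLp.toLp 2 fun i => wienerMap hW (rowStep hg t i) ω with hB
  -- Any exponents meeting Kolmogorov's condition would do; here `5 · (1/2 - 1/4) = 5/4 > 1`.
  obtain ⟨p, α, hp0, hα, hp⟩ : ∃ (p : ℕ) (α : ℝ), p ≠ 0 ∧ 0 < α ∧ 1 < p * (1 / 2 - α) :=
    ⟨5, 1 / 4, by norm_num⟩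
  have hBt := ae_dyadicSum_ne_top (hW := hW) (A := B) hg (fun t i => EventuallyEq.rfl) hp
  have hex : ∀ ω, ∃ f : unitInterval → E n, Continuous f ∧
      (dyadicSum p α (fun t => B t ω) ≠ ∞ →
        ∀ t, Tendsto (fun k => B (dyadicFloor k t) ω) atTop (𝓝 (f t))) := by
    intro ω
    by_cases h : dyadicSum p α (fun t => B t ω) = ∞
    -- The zero path on the null set where the dyadic sum diverges makes every path continuous.
    · exact ⟨fun _ => 0, continuous_const, fun h' => absurd h h'⟩
    · obtain ⟨f, hf, hf'⟩ := exists_continuous_limit hp0 hα h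
      exact ⟨f, hf, fun _ => hf'⟩
  choose f hfc hf using hex
  refine ⟨fun t ω => f ω t, fun t i => ?_, Eventually.of_forall hfc⟩
  rw [wienerIntegral_row hW hg]
  have h1 : TendstoInMeasure P (fun k => (wienerMap hW (rowStep hg (dyadicFloor k t) i) : Ω → ℝ))
      atTop fun ω => f ω t i := by
    refine tendstoInMeasure_of_tendsto_ae (fun k => Lp.aestronglyMeasurable _) ?_
    filter_upwards [hBt] with ω hω
    exact ((EuclideanSpace.proj (𝕜 := ℝ) i : E n →L[ℝ] ℝ).continuous.tendsto _).comp (hf ω hω t)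
  have h2 : TendstoInMeasure P (fun k => (wienerMap hW (rowStep hg (dyadicFloor k t) i) : Ω → ℝ))
      atTop (wienerMap hW (rowStep hg t i)) := by
    refine tendstoInMeasure_of_tendsto_Lp (((wienerMap hW).continuous.tendsto _).comp ?_)
    obtain ⟨L, -, hL⟩ := exists_norm_rowStep_sub_le hg
    rw [tendsto_iff_norm_sub_tendsto_zero]
    refine squeeze_zero (fun _ => norm_nonneg _) (fun k => hL _ _ i) ?_
    have hcont : Continuous fun s : unitInterval => L * √|(s : ℝ) - t| := by fun_prop
    have h3 := (hcont.tendsto t).comp (tendsto_dyadicFloor t)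
    simpa [Function.comp_def] using h3
  exact tendstoInMeasure_ae_unique h1 h2

theorem tendsto_lintegral_dyadicSum {hW : IsBrownianMotion W P}
    (hA : IsWienerIntegralProcess hW g A)
    (hg : ∀ i j, ContinuousOn (fun t => g t i j) (Icc 0 1)) {d : ℕ → ℕ}
    (b : ∀ k, Fin (d k) → Lp (E n) 2 leb) (hb : ∀ k f, ‖residual (b k) f‖ ≤ ‖f‖)
    (hlim : ∀ k i c, Tendsto (fun j => residual (b j) (rowStep hg (dyadic k i) c)) atTop (𝓝 0))
    {p : ℕ} {α : ℝ} (hp : 1 < p * (1 / 2 - α)) :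
    Tendsto (fun j => ∫⁻ ω, dyadicSum p α
      (fun t => pairing hg (whiteNoise hW (b j) ω) t - A t ω) ∂P) atTop (𝓝 0) := by
  have hp0 : p ≠ 0 := by
    rintro rfl
    norm_num at hp
  obtain ⟨L, hL0, hL⟩ := exists_norm_rowStep_sub_le hg
  have h1 := tendsto_kernelSum hL0 (ψ := fun j t i => residual (b j) (rowStep hg t i))
    (fun j s t c => by
      rw [residual_sub]
      exact (hb j _).trans (hL s t c)) hlim hp
  have h2 := ENNReal.Tendsto.const_mul h1
    (Or.inr (ENNReal.pow_ne_top (gaussNorm_ne_top p) : gaussNorm p ^ p ≠ ∞))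
  rw [mul_zero] at h2
  exact tendsto_of_tendsto_of_tendsto_of_le_of_le tendsto_const_nhds h2 (fun _ => zero_le)
    fun j => lintegral_dyadicSum_le (pairing_whiteNoise_sub_ae_eq hA hg (b j)) hp0 α

/-- Markov's inequality for the dyadic sum of the error. A deviation of at least `ε` forces that sum
to be at least `(ε / (C + 1)) ^ p`, the `+ 1` keeping the divisor nonzero. -/
theorem tendstoInMeasure_holderNorm {hW : IsBrownianMotion W P}
    (hA : IsWienerIntegralProcess hW g A)
    (hg : ∀ i j, ContinuousOn (fun t => g t i j) (Icc 0 1)) {d : ℕ → ℕ}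
    (b : ∀ k, Fin (d k) → Lp (E n) 2 leb) (hb : ∀ k f, ‖residual (b k) f‖ ≤ ‖f‖)
    (hlim : ∀ k i c, Tendsto (fun j => residual (b j) (rowStep hg (dyadic k i) c)) atTop (𝓝 0))
    {α : ℝ} (hα0 : 0 < α) (hα : α < 1 / 2)
    (hfin : ∀ᵐ ω ∂P, holderNorm α (fun t => A t ω) < ∞) :
    TendstoInMeasure P (fun k ω => (holderNorm α (pairing hg (whiteNoise hW (b k) ω))).toReal)
      atTop (fun ω => (holderNorm α fun t => A t ω).toReal) := by
  obtain ⟨p, hp⟩ := exists_nat_gt (1 / (1 / 2 - α))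
  rw [div_lt_iff₀ (by linarith)] at hp
  have hp0 : p ≠ 0 := by
    rintro rfl
    norm_num at hp
  obtain ⟨C, hC⟩ := exists_holderNorm_le_dyadicSum n hα0
  refine tendstoInMeasure_of_ne_top fun ε hε hε' => ?_
  have hη0 : (ε / (C + 1)) ^ p ≠ 0 :=
    pow_ne_zero _ (ENNReal.div_pos hε.ne' (by finiteness)).ne'
  have hη1 : (ε / (C + 1)) ^ p ≠ ∞ :=
    ENNReal.pow_ne_top (ENNReal.div_ne_top hε' (by simp))
  have h1 := ENNReal.Tendsto.div_const (tendsto_lintegral_dyadicSum hA hg b hb hlim hp)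
    (Or.inr hη0 : (0 : ℝ≥0∞) ≠ 0 ∨ (ε / (C + 1)) ^ p ≠ 0)
  rw [ENNReal.zero_div] at h1
  refine tendsto_of_tendsto_of_tendsto_of_le_of_le tendsto_const_nhds h1 (fun _ => zero_le)
    fun j => ?_
  have hm : AEMeasurable (fun ω => dyadicSum p α
      (fun t => pairing hg (whiteNoise hW (b j) ω) t - A t ω)) P :=
    aemeasurable_dyadicSum
      (aemeasurable_of_ae_eq_wienerMap (pairing_whiteNoise_sub_ae_eq hA hg (b j))) p α
  refine le_trans (measure_mono_ae ?_) (meas_ge_le_lintegral_div hm hη0 hη1)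
  filter_upwards [hA.continuous_paths, hA.ae_zero hg, hfin] with ω h2 h3 h4 h5
  have h6 := hC p hp0 (fun t => pairing hg (whiteNoise hW (b j) ω) t - A t ω)
    ((continuous_pairing hg _).sub h2) (by rw [h3, pairing_zero_left, sub_zero])
  have h7 : ε ≤ (C + 1) * dyadicSum p α
      (fun t => pairing hg (whiteNoise hW (b j) ω) t - A t ω) ^ (p⁻¹ : ℝ) :=
    (le_trans h5 (edist_toReal_holderNorm_le α (holderNorm_pairing_ne_top hg _ hα0 hα)
      h4.ne)).trans (h6.trans (by gcongr; exact le_self_add))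
  have h8 : ε / (C + 1) ≤ dyadicSum p α
      (fun t => pairing hg (whiteNoise hW (b j) ω) t - A t ω) ^ (p⁻¹ : ℝ) :=
    ENNReal.div_le_of_le_mul' h7
  have h9 := pow_le_pow_left' h8 p
  rwa [ENNReal.rpow_inv_natCast_pow hp0] at h9

theorem ae_holderNorm_lt_top {hW : IsBrownianMotion W P}
    (hA : IsWienerIntegralProcess hW g A)
    (hg : ∀ i j, ContinuousOn (fun t => g t i j) (Icc 0 1))
    {α : ℝ} (hα0 : 0 < α) (hα : α < 1 / 2) :
    ∀ᵐ ω ∂P, holderNorm α (fun t => A t ω) < ∞ := by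
  obtain ⟨p, hp⟩ := exists_nat_gt (1 / (1 / 2 - α))
  rw [div_lt_iff₀ (by linarith)] at hp
  have hp0 : p ≠ 0 := by
    rintro rfl
    norm_num at hp
  obtain ⟨C, hC⟩ := exists_holderNorm_le_dyadicSum n hα0
  filter_upwards [hA.continuous_paths, hA.ae_zero hg,
    ae_dyadicSum_ne_top hg (hA.ae_eq_wienerMap hg) hp] with ω h1 h2 h3
  exact (hC p hp0 _ h1 h2).trans_lt (ENNReal.mul_lt_top ENNReal.coe_lt_top
    (ENNReal.rpow_lt_top_of_nonneg (by positivity) h3))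

/-! ### Positive probability of small balls -/

/-- The event that the coefficients of the approximation are small is independent of the event that
the remainder is small. -/
theorem measure_whiteNoise_small_inter_pos {hW : IsBrownianMotion W P}
    (hA : IsWienerIntegralProcess hW g A)
    (hg : ∀ i j, ContinuousOn (fun t => g t i j) (Icc 0 1)) {b : Fin d → Lp (E n) 2 leb}
    (hb : Orthonormal ℝ b) {p : ℕ} {α δ : ℝ} (hδ : 0 < δ) {η : ℝ≥0∞} (hη : η ≠ ∞)
    (h : ∫⁻ ω, dyadicSum p α (fun t => pairing hg (whiteNoise hW b ω) t - A t ω) ∂P < η) :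
    0 < P ({ω | ∀ j, |wienerMap hW (b j) ω| ≤ δ} ∩
      {ω | dyadicSum p α (fun t => pairing hg (whiteNoise hW b ω) t - A t ω) < η}) := by
  set K : Ω → ℝ≥0∞ := fun ω =>
    dyadicSum p α (fun t => pairing hg (whiteNoise hW b ω) t - A t ω) with hK
  have hη0 : η ≠ 0 := (zero_le.trans_lt h).ne'
  have hm : AEMeasurable K P := aemeasurable_dyadicSum
    (aemeasurable_of_ae_eq_wienerMap (pairing_whiteNoise_sub_ae_eq hA hg b)) p α
  -- Markov: an expectation below `η` is incompatible with `K ≥ η` almost surely.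
  have hKpos : P {ω | K ω < η} ≠ 0 := by
    intro h0
    have h1 : P {ω | η ≤ K ω} < 1 :=
      (meas_ge_le_lintegral_div hm hη0 hη).trans_lt
        ((ENNReal.div_lt_iff (Or.inl hη0) (Or.inl hη)).2 (by rwa [one_mul]))
    have h2 : (univ : Set Ω) ⊆ {ω | η ≤ K ω} ∪ {ω | K ω < η} := fun ω _ => le_or_gt η (K ω)
    have h3 := (measure_mono (μ := P) h2).trans (measure_union_le _ _)
    rw [h0, add_zero, measure_univ] at h3
    exact absurd h1 (not_lt.2 h3)
  -- Only countably many dyadic times enter `K`, so almost surely it is a measurable function `Ψ` of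
  -- the countable Gaussian family `Z`, to which independence applies.
  let v : ℕ × ℕ × Fin n → Lp (E n) 2 leb := fun x =>
    residual b (rowStep hg (dyadic x.1 x.2.1) x.2.2)
  let Z : Ω → (ℕ × ℕ × Fin n → ℝ) := fun ω x => wienerMap hW (v x) ω
  let Ψ : (ℕ × ℕ × Fin n → ℝ) → ℝ≥0∞ := fun z =>
    ∑' k : ℕ, ∑ i ∈ Finset.range (2 ^ k), (ENNReal.ofReal (2 ^ α) ^ k *
      ‖(WithLp.toLp 2 fun c => z (k, i + 1, c) : E n) - WithLp.toLp 2 fun c => z (k, i, c)‖ₑ) ^ p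
  have hΨ : Measurable Ψ := by
    refine Measurable.tsum fun k => Finset.measurable_fun_sum _ fun i _ => ?_
    have hz : ∀ i, Measurable fun z : ℕ × ℕ × Fin n → ℝ =>
        (WithLp.toLp 2 fun c => z (k, i, c) : E n) := fun i =>
      (WithLp.measurable_toLp 2 (Fin n → ℝ)).comp
        (measurable_pi_iff.2 fun c => measurable_pi_apply _)
    exact (((hz _).sub (hz _)).enorm.const_mul _).pow_const _
  have hKΨ : ∀ᵐ ω ∂P, K ω = Ψ (Z ω) := by
    have h1 : ∀ᵐ ω ∂P, ∀ x : ℕ × ℕ × Fin n,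
        (pairing hg (whiteNoise hW b ω) (dyadic x.1 x.2.1) - A (dyadic x.1 x.2.1) ω) x.2.2 =
          Z ω x :=
      ae_all_iff.2 fun x => pairing_whiteNoise_sub_ae_eq hA hg b _ _
    filter_upwards [h1] with ω hω
    have h2 : ∀ k i, pairing hg (whiteNoise hW b ω) (dyadic k i) - A (dyadic k i) ω =
        WithLp.toLp 2 fun c => Z ω (k, i, c) := by
      intro k i
      ext c
      exact hω (k, i, c)
    simp only [hK, dyadicSum, h2, Ψ]
  have hind := indepFun_wienerMap hW b v fun j x => inner_residual_eq_zero hb j _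
  have hS : MeasurableSet {x : Fin d → ℝ | ∀ j, |x j| ≤ δ} := by
    rw [Set.ofPred_forall]
    exact MeasurableSet.iInter fun j => measurableSet_le (by fun_prop) (by fun_prop)
  have h1 := hind.measure_inter_preimage_eq_mul _ {z | Ψ z < η} hS
    (measurableSet_lt hΨ measurable_const)
  have h2 : P (Z ⁻¹' {z | Ψ z < η}) = P {ω | K ω < η} := by
    refine measure_congr ?_
    filter_upwards [hKΨ] with ω hω
    change (Ψ (Z ω) < η) = (K ω < η)
    rw [hω]
  have h3 : P ({ω | ∀ j, |wienerMap hW (b j) ω| ≤ δ} ∩ {ω | K ω < η}) =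
      P ({ω | ∀ j, |wienerMap hW (b j) ω| ≤ δ} ∩ Z ⁻¹' {z | Ψ z < η}) := by
    refine measure_congr ?_
    filter_upwards [hKΨ] with ω hω
    change (_ ∧ K ω < η) = (_ ∧ Ψ (Z ω) < η)
    rw [hω]
  rw [h3]
  refine pos_iff_ne_zero.2 fun h0 => ?_
  have h4 : P ({ω | ∀ j, |wienerMap hW (b j) ω| ≤ δ}) * P (Z ⁻¹' {z | Ψ z < η}) = 0 :=
    h1.symm.trans h0
  rw [h2, mul_eq_zero] at h4
  exact h4.elim (measure_forall_abs_wienerMap_le_pos hW hb hδ).ne' hKpos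

/-- Project onto the span of the kernels with level and index at most `N`: each fixed kernel is
eventually in the range, and its residual is then zero. -/
theorem exists_orthonormal_residual_tendsto
    (hg : ∀ i j, ContinuousOn (fun t => g t i j) (Icc 0 1)) :
    ∃ (d : ℕ → ℕ) (b : ∀ k, Fin (d k) → Lp (E n) 2 leb), (∀ k, Orthonormal ℝ (b k)) ∧
      (∀ k f, ‖residual (b k) f‖ ≤ ‖f‖) ∧
      ∀ k i c, Tendsto (fun j => residual (b j) (rowStep hg (dyadic k i) c)) atTop (𝓝 0) := by
  obtain ⟨V, hV, hmem⟩ : ∃ V : ℕ → Submodule ℝ (Lp (E n) 2 leb),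
      (∀ N, FiniteDimensional ℝ (V N)) ∧
      ∀ k i c N, max k i ≤ N → rowStep hg (dyadic k i) c ∈ V N :=
    ⟨fun N => Submodule.span ℝ (range fun x : Fin (N + 1) × Fin (N + 1) × Fin n =>
        rowStep hg (dyadic x.1 x.2.1) x.2.2),
      fun N => FiniteDimensional.span_of_finite ℝ (finite_range _),
      fun k i c N hN => Submodule.subset_span ⟨(⟨k, by omega⟩, ⟨i, by omega⟩, c), rfl⟩⟩
  refine ⟨fun N => Module.finrank ℝ (V N),
    fun N j => ((stdOrthonormalBasis ℝ (V N) j : V N) : Lp (E n) 2 leb),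
    fun N => (stdOrthonormalBasis ℝ (V N)).orthonormal.comp_linearIsometry (V N).subtypeₗᵢ,
    fun N f => norm_residual_le (stdOrthonormalBasis ℝ (V N)) f, fun k i c => ?_⟩
  refine tendsto_const_nhds.congr' ?_
  filter_upwards [eventually_ge_atTop (max k i)] with N hN
  rw [residual_eq_starProjection_sub,
    Submodule.starProjection_eq_self_iff.2 (hmem k i c N hN), sub_self]

/-- Split `ε` in half between the error of one good approximation and the approximation itself, a
finite combination of fixed paths of finite Hölder norm with small random coefficients. -/
theorem measure_holderNorm_le_pos {hW : IsBrownianMotion W P}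
    (hA : IsWienerIntegralProcess hW g A)
    (hg : ∀ i j, ContinuousOn (fun t => g t i j) (Icc 0 1))
    {α : ℝ} (hα0 : 0 < α) (hα : α < 1 / 2) {ε : ℝ} (hε : 0 < ε) :
    0 < P {ω | holderNorm α (fun t => A t ω) ≤ ENNReal.ofReal ε} := by
  obtain ⟨p, hp⟩ := exists_nat_gt (1 / (1 / 2 - α))
  rw [div_lt_iff₀ (by linarith)] at hp
  have hp0 : p ≠ 0 := by
    rintro rfl
    norm_num at hp
  obtain ⟨C, hC⟩ := exists_holderNorm_le_dyadicSum n hα0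
  obtain ⟨d, b, hb1, hb2, hb3⟩ := exists_orthonormal_residual_tendsto hg
  set e : ℝ≥0∞ := ENNReal.ofReal (ε / 2) with he
  have he0 : 0 < e := ENNReal.ofReal_pos.2 (by positivity)
  have hη0 : 0 < (e / (C + 1)) ^ p := ENNReal.pow_pos (ENNReal.div_pos he0.ne' (by finiteness)) p
  have hη1 : (e / (C + 1)) ^ p ≠ ∞ :=
    ENNReal.pow_ne_top (ENNReal.div_ne_top ENNReal.ofReal_ne_top (by simp))
  obtain ⟨j, hj⟩ := ((tendsto_lintegral_dyadicSum hA hg b hb2 hb3 hp).eventually_lt_const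
    hη0).exists
  set S : ℝ≥0∞ := ∑ i, holderNorm α (pairing hg (b j i)) with hS
  have hSt : S ≠ ∞ := ENNReal.sum_ne_top.2 fun i _ => holderNorm_pairing_ne_top hg _ hα0 hα
  obtain ⟨δ, hδ0, hδ⟩ : ∃ δ : ℝ, 0 < δ ∧ ENNReal.ofReal δ * S ≤ e := by
    -- The `+ 1` covers `S = 0`.
    refine ⟨ε / 2 / (S.toReal + 1), by positivity, ?_⟩
    rw [← ENNReal.ofReal_toReal hSt, ← ENNReal.ofReal_mul (by positivity), he]
    refine ENNReal.ofReal_le_ofReal ?_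
    rw [ENNReal.toReal_ofReal ENNReal.toReal_nonneg, div_mul_eq_mul_div,
      div_le_iff₀ (by positivity)]
    gcongr
    linarith
  refine (measure_whiteNoise_small_inter_pos hA hg (hb1 j) hδ0 hη1 hj).trans_le
    (measure_mono_ae ?_)
  filter_upwards [hA.continuous_paths, hA.ae_zero hg] with ω h2 h3 h4
  obtain ⟨h5, h6⟩ := h4
  have h7 := hC p hp0 (fun t => pairing hg (whiteNoise hW (b j) ω) t - A t ω)
    ((continuous_pairing hg _).sub h2) (by rw [h3, pairing_zero_left, sub_zero])
  have h8 : holderNorm α ((fun t => A t ω) - pairing hg (whiteNoise hW (b j) ω)) ≤ e := by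
    rw [holderNorm_sub_comm]
    refine h7.trans ?_
    calc _ ≤ (C + 1) * ((e / (C + 1)) ^ p) ^ (p⁻¹ : ℝ) := by
          gcongr
          · exact le_self_add
          · exact h6.le
      _ = (C + 1) * (e / (C + 1)) := by rw [ENNReal.pow_rpow_inv_natCast hp0]
      _ ≤ e := ENNReal.mul_div_le
  change holderNorm α (fun t => A t ω) ≤ ENNReal.ofReal ε
  calc holderNorm α (fun t => A t ω)
      ≤ holderNorm α (pairing hg (whiteNoise hW (b j) ω)) +
        holderNorm α ((fun t => A t ω) - pairing hg (whiteNoise hW (b j) ω)) :=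
        holderNorm_le_add_sub _ _ _
    _ ≤ e + e := add_le_add ((holderNorm_pairing_whiteNoise_le hW hg (b j) h5).trans hδ) h8
    _ = ENNReal.ofReal ε := by
        rw [he, ← ENNReal.ofReal_add (by positivity) (by positivity), add_halves]

theorem isStochasticExtension_holderNorm {hW : IsBrownianMotion W P}
    (hA : IsWienerIntegralProcess hW g A)
    (hg : ∀ i j, ContinuousOn (fun t => g t i j) (Icc 0 1))
    {α : ℝ} (hα0 : 0 < α) (hα : α < 1 / 2) :
    IsStochasticExtension hW (Ng g α) (fun ω => holderNorm α (fun t => A t ω)) where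
  aemeasurable := hA.aemeasurable_holderNorm hg α
  ae_lt_top := ae_holderNorm_lt_top hA hg hα0 hα
  tendsto V _ hV d b := by
    simp only [Ng_eq hg, derLp_projW]
    refine tendstoInMeasure_holderNorm hA hg _ (fun k f => ?_) (fun k i c => ?_) hα0 hα
      (ae_holderNorm_lt_top hA hg hα0 hα)
    -- The basis consists of elements of `H¹`; writing `f` as a derivative makes its residual the
    -- image of an `H¹` residual under the isometry.
    · obtain ⟨h, rfl⟩ := derLp_surjective n f
      rw [residual_map, LinearIsometry.norm_map, LinearIsometry.norm_map]
      exact norm_residual_le (b k) h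
    · obtain ⟨h, hh⟩ := derLp_surjective n (rowStep hg (dyadic k i) c)
      rw [← hh]
      simp only [residual_map, residual_eq_starProjection_sub]
      have h1 := ((derLp n).continuous.tendsto _).comp ((hV h).sub_const h)
      simpa [Function.comp_def] using h1
  pos _ hε := measure_holderNorm_le_pos hA hg hα0 hα hε

end

end WienerSpace

open WienerSpace
theorem lemma2p8 {Ω : Type*} [MeasurableSpace Ω] (P : Measure Ω) [IsProbabilityMeasure P]
    (n : ℕ) (W : unitInterval → Ω → E n) (hW : IsBrownianMotion W P)
    (g : ℝ → Matrix (Fin n) (Fin n) ℝ)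
    (hg : ∀ i j, ContDiffOn ℝ 2 (fun t => g t i j) (Icc 0 1))
    (m M : ℝ) (hm : 0 < m) (hdet : ∀ t ∈ Icc (0 : ℝ) 1, m ≤ (g t).det ∧ (g t).det ≤ M)
    (α : ℝ) (hα0 : 0 < α) (hα : α < 1 / 2) :
    IsMeasurableNorm hW (Ng g α) ∧
    (∃ A : unitInterval → Ω → E n, IsWienerIntegralProcess hW g A) ∧
    ∀ A : unitInterval → Ω → E n, IsWienerIntegralProcess hW g A →
      IsStochasticExtension hW (Ng g α) (fun ω => holderNorm α (fun t => A t ω)) := by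
  have hc : ∀ i j, ContinuousOn (fun t => g t i j) (Icc 0 1) := fun i j => (hg i j).continuousOn
  obtain ⟨A, hA⟩ := exists_isWienerIntegralProcess hW hc
  exact ⟨⟨⟨isSeminorm_Ng hc hα0 hα, _, isStochasticExtension_holderNorm hA hc hα0 hα⟩,
      fun h h0 => eq_zero_of_Ng_eq_zero hc (fun t ht => (hm.trans_le (hdet t ht).1).ne') h0⟩,
    ⟨A, hA⟩, fun B hB => isStochasticExtension_holderNorm hB hc hα0 hα⟩
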